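/- **Setting.** Let $K$ be a field and let $A$ be a finite-dimensional unital commutative Frobenius algebra over $K$ with counit $\epsilon:A\to K$, so that $\eta(u,v)=\epsilon(uv)$ is non-degenerate. Let $\{e_a\}$ be a $K$-basis of $A$, let $(\eta^{ab})$ be the inverse of the matrix $(\eta(e_a,e_b))$, let $\lambda:A\to A^*$, $\langle\lambda(u),v\rangle=\eta(u,v)$, and let $\delta:A\to A\otimes A$ be the comultiplication, defined by $(\lambda\otimes\lambda)\circ\delta=m^*\circ\lambda$, where $m$ is the multiplication of $A$. Let $\{\omega_{g,n}:A^{\otimes n}\to K\}_{g\ge 0,\,n\ge 1}$ be a 2D TQFT on $A$. That is, $\omega_{0,1}=\epsilon$, $\omega_{0,2}=\eta$, $\omega_{0,3}(u,v,w)=\eta(uv,w)$, and in the stable range $2g-2+n>0$ the maps $\omega_{g,n}$ are $S_n$-invariant and satisfy $$\omega_{g,n+1}(v_1,\dots,v_n,1)=\omega_{g,n}(v_1,\dots,v_n),$$ $$\omega_{g,n}(v_1,\dots,v_n)=\sum_{a,b}\omega_{g-1,n+2}(v_1,\dots,v_n,e_a,e_b)\,\eta^{ab}\quad(g\ge 1),$$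 $$\omega_{g_1+g_2,|I|+|J|}(v_I,v_J)=\sum_{a,b}\eta^{ab}\,\omega_{g_1,|I|+1}(v_I,e_a)\,\omega_{g_2,|J|+1}(v_J,e_b),$$ the last one whenever both factors on the right are in the stable range. A connected cell graph of type $(g,n)$ is the $1$-skeleton of a cell decomposition of a connected closed oriented surface of genus $g$ with $n$ labelled $0$-cells (vertices), up to orientation-preserving homeomorphisms keeping the labels. The degree of a vertex is the number of incident half-edges. An arrowed cell graph has in addition, at each vertex of positive degree, one distinguished (arrowed) incident half-edge; isomorphisms must also preserve the arrowed half-edges. For integers $\mu_i\ge 0$ let $C_{g,n}(\mu_1,\dots,\mu_n)$ be the number of isomorphism classes of connected arrowed cell graphs of type $(g,n)$ whose $i$-th vertex has degree $\mu_i$ for all $i$. Thus $C_{0,1}(0)=1$ (a single point on the sphere). Terms with $g-1<0$ are zero. **Proposition.** For all $g\ge 0$, $n\ge 1$, all integers $\mu_1\ge 1$ and $\mu_2,\dots,\mu_n\ge 0$, and all $v_1,\dots,v_n\in A$, $$ \begin{aligned} &C_{g,n}(\mu_1,\dots,\mu_n)\cdot\omega_{g,n}(v_1,\dots,v_n)\\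 &=\sum_{j=2}^n\mu_j\,C_{g,n-1}(\mu_1+\mu_j-2,\mu_2,\dots,\widehat{\mu_j},\dots,\mu_n)\cdot\omega_{g,n-1}(v_1v_j,v_2,\dots,\widehat{v_j},\dots,v_n)\\ &\quad+\sum_{\alpha+\beta=\mu_1-2}C_{g-1,n+1}(\alpha,\beta,\mu_2,\dots,\mu_n)\cdot\omega_{g-1,n+1}\bigl(\delta(v_1),v_2,\dots,v_n\bigr)\\ &\quad+\sum_{\alpha+\beta=\mu_1-2}\ \sum_{\substack{g_1+g_2=g\\ I\sqcup J=\{2,\dots,n\}}}\ \sum_{a,b,k,\ell}\eta(v_1,e_ke_\ell)\,\eta^{ka}\eta^{\ell b}\\ &\qquad\quad\times\Bigl(C_{g_1,|I|+1}(\alpha,\mu_I)\cdot\omega_{g_1,|I|+1}(e_a,v_I)\Bigr)\Bigl(C_{g_2,|J|+1}(\beta,\mu_J)\cdot\omega_{g_2,|J|+1}(e_b,v_J)\Bigr), \end{aligned} $$ where $\alpha,\beta,g_1,g_2\ge 0$ are integers, $(I,J)$ runs over ordered pairs, and terms with $\mu_j=0$ in the first sum are zero. -/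

import Mathlib

open scoped TensorProduct

/-! ### Cell graphs -/

/-- A cell graph with vertices labelled by `V`, given by its half-edges (a ribbon graph, or
combinatorial map): `rot` sends a half-edge to the next one around its vertex, in the cyclic order
induced by the orientation of the surface, and `flip` exchanges the two halves of each edge.
The vertices carrying half-edges are the cycles of `rot`, labelled injectively by `vertex`; a label
that is not in the range of `vertex` is the label of a vertex without half-edges. -/
structure CellGraph (V : Type) where
  HalfEdge : Type
  finite_halfEdge : Finite HalfEdge
  rot : Equiv.Perm HalfEdge
  flip : Equiv.Perm HalfEdge
  flip_flip : ∀ h, flip (flip h) = h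
  flip_ne : ∀ h, flip h ≠ h
  vertex : HalfEdge → V
  vertex_eq_iff : ∀ h k, vertex h = vertex k ↔ rot.SameCycle h k

namespace CellGraph

variable {V : Type} (Γ : CellGraph V)

/-- Connectedness of the underlying graph. -/
def Connected : Prop :=
  (SimpleGraph.fromRel fun i j : V => ∃ h, Γ.vertex h = i ∧ Γ.vertex (Γ.flip h) = j).Connected

/-- The degree of a vertex: the number of incident half-edges. -/
noncomputable def degree (i : V) : ℕ := Nat.card {h : Γ.HalfEdge // Γ.vertex h = i}

/-- The number of edges, i.e. of pairs `{h, flip h}`. -/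
noncomputable def numEdges : ℕ := Nat.card (Quotient (Equiv.Perm.SameCycle.setoid Γ.flip))

/-- The number of faces. The boundary of a face is traversed by following an edge and then turning
to the next half-edge; a vertex without half-edges is alone on its sphere, with a single face. -/
noncomputable def numFaces : ℕ :=
  Nat.card (Quotient (Equiv.Perm.SameCycle.setoid (Γ.rot * Γ.flip))) +
    Nat.card {i : V // ∀ h, Γ.vertex h ≠ i}

/-- A connected cell graph drawn on the closed oriented surface of genus `g`, i.e. one whose cells
satisfy `c₀ - c₁ + c₂ = 2 - 2 g`. -/
def IsConnectedOfGenus (g : ℕ) : Prop :=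
  Γ.Connected ∧ (Nat.card V : ℤ) - Γ.numEdges + Γ.numFaces = 2 - 2 * (g : ℤ)

end CellGraph

/-- An arrowed cell graph: at each vertex one of the incident half-edges (if there are any)
carries an arrow. -/
structure ArrowedCellGraph (V : Type) extends CellGraph V where
  arrows : Set HalfEdge
  existsUnique_arrow : ∀ h, ∃! a, a ∈ arrows ∧ vertex a = vertex h

namespace ArrowedCellGraph

variable {V : Type}

/-- Isomorphisms (orientation preserving homeomorphisms of surfaces, seen on half-edges) keep the
cyclic orders, the edges, the labels of the vertices and the arrows. -/
def Isomorphic (Γ Γ' : ArrowedCellGraph V) : Prop :=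
  ∃ f : Γ.HalfEdge ≃ Γ'.HalfEdge,
    (∀ h, f (Γ.rot h) = Γ'.rot (f h)) ∧ (∀ h, f (Γ.flip h) = Γ'.flip (f h)) ∧
    (∀ h, Γ'.vertex (f h) = Γ.vertex h) ∧ ∀ h, f h ∈ Γ'.arrows ↔ h ∈ Γ.arrows

/-- The connected arrowed cell graphs of genus `g` whose vertex `i` has degree `μ i`, up to
isomorphism. -/
def setoid (g : ℕ) (μ : V → ℕ) :
    Setoid {Γ : ArrowedCellGraph V //
      Γ.toCellGraph.IsConnectedOfGenus g ∧ ∀ i, Γ.toCellGraph.degree i = μ i} where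
  r Γ Γ' := Isomorphic Γ.1 Γ'.1
  iseqv :=
    { refl := fun _ => ⟨Equiv.refl _, by simp⟩
      symm := by
        rintro Γ Γ' ⟨f, h1, h2, h3, h4⟩
        refine ⟨f.symm, fun h => ?_, fun h => ?_, fun h => ?_, fun h => ?_⟩
        · rw [Equiv.symm_apply_eq, h1, f.apply_symm_apply]
        · rw [Equiv.symm_apply_eq, h2, f.apply_symm_apply]
        · rw [← h3, f.apply_symm_apply]
        · rw [← h4, f.apply_symm_apply]
      trans := by
        rintro Γ Γ' Γ'' ⟨f, h1, h2, h3, h4⟩ ⟨f', h1', h2', h3', h4'⟩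
        exact ⟨f.trans f', by simp [h1, h1'], by simp [h2, h2'], by simp [h3, h3'],
          by simp [h4, h4']⟩ }

/-- `C_{g,n}(μ)`: the number of arrowed cell graphs of genus `g` with vertices labelled by `V`
(so `n = |V|`) of degrees `μ`. -/
noncomputable def count (g : ℕ) (μ : V → ℕ) : ℕ := Nat.card (Quotient (setoid g μ))

end ArrowedCellGraph

/-! ### Commutative Frobenius algebras -/

/-- A counit making the finite-dimensional commutative `K`-algebra `A` a Frobenius algebra. -/
structure FrobeniusCounit (K A : Type*) [Field K] [CommRing A] [Algebra K A] where
  counit : A →ₗ[K] K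
  eq_zero_of_counit : ∀ u, (∀ x, counit (u * x) = 0) → u = 0

namespace FrobeniusCounit

variable {K A : Type*} [Field K] [CommRing A] [Algebra K A] (F : FrobeniusCounit K A)

/-- The Frobenius form `η(u, v) = ε(u v)`. -/
def eta : A →ₗ[K] Module.Dual K A := (LinearMap.mul K A).compr₂ F.counit

theorem eta_apply (u v : A) : F.eta u v = F.counit (u * v) := rfl

theorem eta_injective : Function.Injective F.eta :=
  (injective_iff_map_eq_zero F.eta).2 fun u hu =>
    F.eq_zero_of_counit u fun x => by rw [← F.eta_apply, hu, LinearMap.zero_apply]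

/-- The isomorphism `λ : A ≅ A*`, `⟨λ(u), v⟩ = η(u, v)`. -/
noncomputable def toDual [FiniteDimensional K A] : A ≃ₗ[K] Module.Dual K A :=
  LinearEquiv.ofInjectiveOfFinrankEq F.eta F.eta_injective Subspace.dual_finrank_eq.symm

/-- The comultiplication `δ : A → A ⊗ A`: the map with `(λ ⊗ λ) ∘ δ = m* ∘ λ`, where `A* ⊗ A*` is
identified with `(A ⊗ A)*`. As `A` is commutative, the order of the factors does not matter. -/
noncomputable def comul [FiniteDimensional K A] : A →ₗ[K] A ⊗[K] A :=
  (TensorProduct.congr F.toDual F.toDual).symm.toLinearMap ∘ₗ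
    (TensorProduct.dualDistribEquiv K A A).symm.toLinearMap ∘ₗ
      (LinearMap.mul' K A).dualMap ∘ₗ F.toDual.toLinearMap

/-- The inverse `(η^{ab})` of the matrix `(η(e_a, e_b))`. -/
noncomputable def etaInv {ι : Type*} [Fintype ι] [DecidableEq ι] (e : Module.Basis ι K A) :
    Matrix ι ι K :=
  (Matrix.of fun a b => F.eta (e a) (e b))⁻¹

end FrobeniusCounit

/-! ### Two-dimensional topological quantum field theories -/

/-- A 2D TQFT on the Frobenius algebra `A` with basis `e`: linear maps `ω_{g,n} : A^{⊗ n} → K` for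
`g ≥ 0` and `n ≥ 1` that form a cohomological field theory with values in degree zero
cohomology in the stable range `2 g - 2 + n > 0`, and with `ω_{0,1} = ε` and `ω_{0,2} = η`.
(The values at `n = 0` are not constrained and play no role.) -/
structure TQFT {K A : Type*} [Field K] [CommRing A] [Algebra K A] (F : FrobeniusCounit K A)
    {ι : Type*} [Fintype ι] [DecidableEq ι] (e : Module.Basis ι K A) where
  ω : (g n : ℕ) → MultilinearMap K (fun _ : Fin n => A) K
  ω_zero_one : ∀ u, ω 0 1 ![u] = F.counit u
  ω_zero_two : ∀ u v, ω 0 2 ![u, v] = F.eta u v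
  ω_zero_three : ∀ u v w, ω 0 3 ![u, v, w] = F.eta (u * v) w
  ω_perm : ∀ g n, 0 < n → 2 < 2 * g + n →
    ∀ (s : Equiv.Perm (Fin n)) (v : Fin n → A), ω g n (fun i => v (s i)) = ω g n v
  ω_one : ∀ g n, 0 < n → 2 < 2 * g + n →
    ∀ v : Fin n → A, ω g (n + 1) (Fin.append v ![1]) = ω g n v
  ω_handle : ∀ g n, 0 < n → ∀ v : Fin n → A,
    ω (g + 1) n v = ∑ a, ∑ b, ω g (n + 2) (Fin.append v ![e a, e b]) * F.etaInv e a b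
  ω_split : ∀ g₁ g₂ m n, 0 < m + n → 2 < 2 * g₁ + (m + 1) → 2 < 2 * g₂ + (n + 1) →
    ∀ (v : Fin m → A) (w : Fin n → A),
      ω (g₁ + g₂) (m + n) (Fin.append v w) =
        ∑ a, ∑ b, F.etaInv e a b *
          (ω g₁ (m + 1) (Fin.append v ![e a]) * ω g₂ (n + 1) (Fin.append w ![e b]))

/-! ### Notation for the recursion -/

/-- The linear map `t ↦ f(t, v₁, …, vₙ)` on `A ⊗ A` for a multilinear map `f` in `n + 2`
variables. -/
noncomputable def MultilinearMap.onTensor {K A : Type*} [Field K] [CommRing A] [Algebra K A]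
    {n : ℕ} (f : MultilinearMap K (fun _ : Fin (n + 2) => A) K) (v : Fin n → A) :
    A ⊗[K] A →ₗ[K] K :=
  TensorProduct.lift
    (LinearMap.mk₂ K (fun x y => f (Matrix.vecCons x (Matrix.vecCons y v)))
      (fun x x' y => f.cons_add (Matrix.vecCons y v) x x')
      (fun c x y => f.cons_smul (Matrix.vecCons y v) c x)
      (fun x y y' => by
        have h := (f.curryLeft x).cons_add v y y'
        exact h)
      (fun c x y => by
        have h := (f.curryLeft x).cons_smul v c y
        exact h))

/-- The subfamily `x_I`, listed in increasing order of the indices in `I`. -/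
def subfamily {X : Type*} {n : ℕ} (I : Finset (Fin n)) (x : Fin n → X) : Fin I.card → X :=
  fun i => x (I.orderEmbOfFin rfl i)

/-- The pairs `(α, β)` of non-negative integers with `α + β = m - 2` (none if `m < 2`). -/
def loopSplittings (m : ℕ) : Finset (ℕ × ℕ) :=
  (Finset.range m ×ˢ Finset.range m).filter fun p => p.1 + p.2 + 2 = m

section

open Equiv Equiv.Perm

/-! ### Cycles of permutations -/

namespace Equiv.Perm

variable {D E V : Type*}

/-- The number of cycles of a permutation, fixed points included. -/
noncomputable def numCycles (f : Perm D) : ℕ := Nat.card (Quotient (SameCycle.setoid f))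

theorem SameCycle.eq_of_invariant [Finite D] {f : Perm D} {v : D → V} (hv : ∀ x, v (f x) = v x)
    {x y : D} (h : f.SameCycle x y) : v x = v y := by
  obtain ⟨n, rfl⟩ := h.exists_nat_pow_eq
  clear h
  induction n with
  | zero => rfl
  | succ n ih => rw [pow_succ', Perm.mul_apply, hv, ih]

/-- `v` labels the cycles of `f`: it takes the same value on two points exactly when they lie in
the same cycle, and each label is used. -/
structure IsCycleLabelling (f : Perm D) (v : D → V) : Prop where
  surjective : Function.Surjective v
  eq_iff : ∀ x y, v x = v y ↔ f.SameCycle x y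

theorem isCycleLabelling_mk (f : Perm D) :
    f.IsCycleLabelling (Quotient.mk (SameCycle.setoid f)) :=
  ⟨Quotient.mk_surjective, fun _ _ => Quotient.eq⟩

namespace IsCycleLabelling

variable {f : Perm D} {v : D → V}

theorem apply (hv : f.IsCycleLabelling v) (x : D) : v (f x) = v x :=
  (hv.eq_iff _ _).2 (sameCycle_apply_left.2 (SameCycle.refl f x))

theorem numCycles_eq (hv : f.IsCycleLabelling v) : f.numCycles = Nat.card V := by
  refine Nat.card_eq_of_bijective
    (Quotient.lift v fun x y h => (hv.eq_iff x y).2 h) ⟨?_, fun i => ?_⟩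
  · rintro ⟨x⟩ ⟨y⟩ h
    exact Quotient.sound ((hv.eq_iff x y).1 h)
  · obtain ⟨x, rfl⟩ := hv.surjective i
    exact ⟨Quotient.mk _ x, rfl⟩

theorem of_injective {W : Type*} (hv : f.IsCycleLabelling v) {ι : W → V}
    (hι : Function.Injective ι) {w : D → W} (hw : ∀ x, ι (w x) = v x) : f.IsCycleLabelling w := by
  refine ⟨fun i => ?_, fun x y => ?_⟩
  · obtain ⟨x, hx⟩ := hv.surjective (ι i)
    exact ⟨x, hι (by rw [hw, hx])⟩
  · rw [← hv.eq_iff, ← hw, ← hw, hι.eq_iff]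

/-- The cycles inside an invariant set that is a union of cycles with labels in the range of `ι`. -/
theorem exists_subtypePerm {W : Type*} (hv : f.IsCycleLabelling v) {ι : W → V}
    (hι : Function.Injective ι) {p : D → Prop} (hp : ∀ x, p x ↔ v x ∈ Set.range ι)
    (hf : ∀ x, p (f x) ↔ p x) :
    ∃ w : {x // p x} → W, (f.subtypePerm hf).IsCycleLabelling w ∧ ∀ x, ι (w x) = v x.1 := by
  choose w hw using fun x : {x // p x} => (hp x.1).1 x.2
  refine ⟨w, ⟨fun i => ?_, fun x y => ?_⟩, hw⟩
  · obtain ⟨x, hx⟩ := hv.surjective (ι i)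
    refine ⟨⟨x, (hp x).2 ⟨i, hx.symm⟩⟩, hι ?_⟩
    rw [hw, hx]
  · rw [sameCycle_subtypePerm, ← hv.eq_iff, ← hw, ← hw, hι.eq_iff]

end IsCycleLabelling

theorem numCycles_congr {f : Perm D} {f' : Perm E} (e : D ≃ E) (h : ∀ x, e (f x) = f' (e x)) :
    f.numCycles = f'.numCycles := by
  have hpow : ∀ (n : ℤ) x, e ((f ^ n) x) = (f' ^ n) (e x) := by
    have : f' = e.permCongr f := by
      ext y
      simp [Equiv.permCongr_apply, h]
    subst this
    intro n x
    change _ = ((e.permCongrHom f) ^ n) (e x)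
    rw [← map_zpow]
    simp
  refine (IsCycleLabelling.numCycles_eq (v := fun x => Quotient.mk (SameCycle.setoid f') (e x))
    ⟨(Quotient.mk_surjective).comp e.surjective, fun x y => ?_⟩)
  rw [(isCycleLabelling_mk f').eq_iff]
  refine ⟨fun ⟨n, hn⟩ => ⟨n, e.injective (by rw [hpow, hn])⟩, fun ⟨n, hn⟩ => ⟨n, ?_⟩⟩
  rw [← hn, hpow]

theorem numCycles_eq_add [Finite D] (f : Perm D) {p : D → Prop} (hf : ∀ x, p (f x) ↔ p x)
    (hf' : ∀ x, ¬ p (f x) ↔ ¬ p x) :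
    f.numCycles = (f.subtypePerm hf).numCycles +
      (f.subtypePerm (p := fun x => ¬ p x) hf').numCycles := by
  classical
  have h1 := isCycleLabelling_mk (f.subtypePerm hf)
  have h2 := isCycleLabelling_mk (f.subtypePerm (p := fun x => ¬ p x) hf')
  unfold numCycles
  rw [← Nat.card_sum]
  refine IsCycleLabelling.numCycles_eq (v := fun x => if h : p x then
    Sum.inl (Quotient.mk _ ⟨x, h⟩) else Sum.inr (Quotient.mk _ ⟨x, h⟩)) ⟨?_, fun x y => ?_⟩
  · rintro (q | q) <;> obtain ⟨x, rfl⟩ := Quotient.mk_surjective q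
    · exact ⟨x.1, dif_pos x.2⟩
    · exact ⟨x.1, dif_neg x.2⟩
  · have hxy : f.SameCycle x y → (p x ↔ p y) := fun h =>
      Eq.to_iff (h.eq_of_invariant (v := p) fun x => propext (hf x))
    by_cases hx : p x <;> by_cases hy : p y
    · simp only [hx, hy, dif_pos, Sum.inl.injEq]
      rw [h1.eq_iff, sameCycle_subtypePerm]
    · simp only [hx, hy, dif_pos, dif_neg, not_false_eq_true, reduceCtorEq, false_iff]
      exact fun h => hy ((hxy h).1 hx)
    · simp only [hx, hy, dif_pos, dif_neg, not_false_eq_true, reduceCtorEq, false_iff]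
      exact fun h => hx ((hxy h).2 hy)
    · simp only [hx, hy, dif_neg, not_false_eq_true, Sum.inr.injEq]
      rw [h2.eq_iff, sameCycle_subtypePerm]

/-- A fixed-point-free involution pairs up the points. -/
theorem card_eq_two_mul_numCycles [Finite D] {f : Perm D} (hf : ∀ x, f (f x) = x)
    (hne : ∀ x, f x ≠ x) : Nat.card D = 2 * f.numCycles := by
  have hl := isCycleLabelling_mk f
  have hsame : ∀ x y, f.SameCycle x y ↔ y = x ∨ y = f x := by
    refine fun x y => ⟨fun h => ?_, ?_⟩
    · obtain ⟨n, rfl⟩ := h.exists_nat_pow_eq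
      clear h
      induction n with
      | zero => exact Or.inl rfl
      | succ n ih =>
        rw [pow_succ', Perm.mul_apply]
        rcases ih with h | h
        · exact Or.inr (by rw [h])
        · exact Or.inl (by rw [h, hf])
    · rintro (rfl | rfl)
      · exact SameCycle.refl _ _
      · exact sameCycle_apply_right.2 (SameCycle.refl _ _)
  have : Nat.card (Quotient (SameCycle.setoid f) × Bool) = Nat.card D := by
    refine Nat.card_eq_of_bijective (fun q => if q.2 then f q.1.out else q.1.out) ⟨?_, fun x => ?_⟩
    · rintro ⟨q, b⟩ ⟨q', b'⟩ h
      have hq : q = q' := by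
        have h' := congrArg (Quotient.mk (SameCycle.setoid f)) h
        have e1 : ∀ (q : Quotient (SameCycle.setoid f)) (b : Bool),
            Quotient.mk (SameCycle.setoid f) (if b then f q.out else q.out) = q := by
          intro q b
          cases b
          · simp
          · simpa using hl.apply q.out
        simpa only [e1] using h'
      subst hq
      cases b <;> cases b' <;> simp_all
      exact absurd h.symm (hne _)
    · have h : f.SameCycle (Quotient.mk (SameCycle.setoid f) x).out x :=
        (hl.eq_iff _ _).1 (Quotient.out_eq _)
      rcases (hsame _ _).1 h with h | h
      · exact ⟨(Quotient.mk _ x, false), h.symm⟩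
      · exact ⟨(Quotient.mk _ x, true), h.symm⟩
  rw [← this, Nat.card_prod, numCycles]
  simp [mul_comm]

/-! ### Multiplying a permutation by a transposition -/

section SwapMul

theorem swap_mul_pow_apply [DecidableEq D] {f : Perm D} {h k x : D} {n : ℕ}
    (hn : ∀ i, 0 < i → i ≤ n → (f ^ i) x ≠ h ∧ (f ^ i) x ≠ k) :
    ((swap h k * f) ^ n) x = (f ^ n) x := by
  induction n with
  | zero => rfl
  | succ n ih =>
    have h1 := hn (n + 1) n.succ_pos le_rfl
    rw [pow_succ', Perm.mul_apply] at h1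
    rw [pow_succ', Perm.mul_apply, ih fun i hi hin => hn i hi (hin.trans n.le_succ),
      Perm.mul_apply, pow_succ', Perm.mul_apply, swap_apply_of_ne_of_ne h1.1 h1.2]

variable [DecidableEq D] [Finite D] (f : Perm D) (h k : D)

theorem sameCycle_swap_mul_of_sameCycle {x y : D} (hxy : f.SameCycle x y) :
    (swap h k * f).SameCycle x y ∨ (swap h k * f).SameCycle h y ∨
      (swap h k * f).SameCycle k y := by
  obtain ⟨n, rfl⟩ := hxy.exists_nat_pow_eq
  clear hxy
  induction n with
  | zero => exact Or.inl (SameCycle.refl _ _)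
  | succ n ih =>
    rw [pow_succ', Perm.mul_apply]
    set y := (f ^ n) x
    by_cases h1 : f y = h
    · exact Or.inr (Or.inl (by rw [h1]))
    by_cases h2 : f y = k
    · exact Or.inr (Or.inr (by rw [h2]))
    have : f y = (swap h k * f) y := by rw [Perm.mul_apply, swap_apply_of_ne_of_ne h1 h2]
    rw [this]
    simpa only [sameCycle_apply_right] using ih

variable {f h k}

theorem sameCycle_swap_mul_of_not_sameCycle (hhk : ¬ f.SameCycle h k) :
    (swap h k * f).SameCycle h k := by
  have hex : ∃ n, (f ^ (n + 1)) h = h := by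
    refine ⟨orderOf f - 1, ?_⟩
    rw [Nat.sub_add_cancel (orderOf_pos f), pow_orderOf_eq_one, Perm.one_apply]
  classical
  obtain ⟨n, hn, hmin⟩ : ∃ n, (f ^ (n + 1)) h = h ∧ ∀ m < n, (f ^ (m + 1)) h ≠ h :=
    ⟨Nat.find hex, Nat.find_spec hex, fun m hm => Nat.find_min hex hm⟩
  have h1 : ((swap h k * f) ^ n) h = (f ^ n) h := by
    refine swap_mul_pow_apply fun i hi hin => ⟨?_, fun hk => hhk ?_⟩
    · obtain ⟨m, rfl⟩ := Nat.exists_eq_succ_of_ne_zero hi.ne'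
      exact hmin m (by omega)
    · rw [← hk]
      exact sameCycle_pow_right.2 (SameCycle.refl _ _)
  have h2 : ((swap h k * f) ^ (n + 1)) h = k := by
    rw [pow_succ', Perm.mul_apply, h1, Perm.mul_apply, ← Perm.mul_apply f, ← pow_succ', hn,
      swap_apply_left]
  have h3 := (sameCycle_pow_right (n := n + 1)).2 (SameCycle.refl (swap h k * f) h)
  rwa [h2] at h3

/-- If `k = f ^ t h` is reached for the first time after `t` steps, then the cycle of `h` is cut
after `t` steps. -/
theorem sameCycle_swap_mul_iff {t : ℕ} (ht : (f ^ t) h = k) (hmin : ∀ s < t, (f ^ s) h ≠ k)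
    (hhk : h ≠ k) {x : D} :
    (swap h k * f).SameCycle h x ↔ ∃ s < t, x = (f ^ s) h := by
  have ht0 : 0 < t := Nat.pos_of_ne_zero fun h0 => hhk (by rw [← ht, h0]; rfl)
  have hne : ∀ s, 0 < s → s < t → (f ^ s) h ≠ h := by
    intro s hs hst hh
    refine hmin (t - s) (by omega) ?_
    rw [← ht]
    conv_rhs => rw [← Nat.sub_add_cancel hst.le, pow_add, Perm.mul_apply, hh]
  refine ⟨fun hx => ?_, ?_⟩
  · have := hx.eq_of_invariant (v := fun x => ∃ s < t, x = (f ^ s) h) fun x => propext ?_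
    · exact this ▸ ⟨0, ht0, rfl⟩
    · constructor
      · rintro ⟨s, hs, hx⟩
        rw [Perm.mul_apply] at hx
        rcases Nat.eq_zero_or_pos s with rfl | hs0
        · refine ⟨t - 1, by omega, f.injective ?_⟩
          rw [← Perm.mul_apply f, ← pow_succ', Nat.sub_add_cancel ht0, ht]
          apply (swap h k).injective
          rw [hx, swap_apply_right]
          rfl
        · refine ⟨s - 1, by omega, f.injective ?_⟩
          rw [← Perm.mul_apply f, ← pow_succ', Nat.sub_add_cancel hs0]
          apply (swap h k).injective
          rw [hx, swap_apply_of_ne_of_ne (hne s hs0 hs) (hmin s hs)]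
      · rintro ⟨s, hs, rfl⟩
        rw [Perm.mul_apply, ← Perm.mul_apply f, ← pow_succ']
        rcases Nat.lt_or_ge (s + 1) t with hs1 | hs1
        · exact ⟨s + 1, hs1, swap_apply_of_ne_of_ne (hne _ s.succ_pos hs1) (hmin _ hs1)⟩
        · refine ⟨0, ht0, ?_⟩
          rw [show s + 1 = t by omega, ht, swap_apply_right]
          rfl
  · rintro ⟨s, hs, rfl⟩
    rw [← swap_mul_pow_apply fun i hi his => ⟨hne i hi (by omega), hmin i (by omega)⟩]
    exact sameCycle_pow_right.2 (SameCycle.refl _ _)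

theorem not_sameCycle_swap_mul (hhk : h ≠ k) (hs : f.SameCycle h k) :
    ¬ (swap h k * f).SameCycle h k := by
  classical
  have hex := hs.exists_nat_pow_eq
  rw [sameCycle_swap_mul_iff (Nat.find_spec hex) (fun s hs => Nat.find_min hex hs) hhk]
  rintro ⟨s, hs, hx⟩
  exact Nat.find_min hex hs hx.symm

variable {v : D → V}

/-- Labelling the cycles after the cycle of `h` has been cut in two: the part of `h` gets the new
label `none`. -/
theorem IsCycleLabelling.swap_mul_of_eq (hv : f.IsCycleLabelling v) (hhk : h ≠ k)
    (hvhk : v h = v k) [DecidablePred fun x => (swap h k * f).SameCycle h x] :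
    (swap h k * f).IsCycleLabelling
      (fun x => if (swap h k * f).SameCycle h x then none else some (v x)) := by
  have hnot := not_sameCycle_swap_mul hhk ((hv.eq_iff _ _).1 hvhk)
  have hinv : ∀ x y, (swap h k * f).SameCycle x y → v x = v y := fun x y hxy =>
    hxy.eq_of_invariant fun x => by
      rw [Perm.mul_apply, swap_apply_def]
      split_ifs with h1 h2
      · rw [← hvhk, ← h1, hv.apply]
      · rw [hvhk, ← h2, hv.apply]
      · exact hv.apply x
  refine ⟨?_, fun x y => ?_⟩
  · rintro (_ | i)
    · exact ⟨h, if_pos (SameCycle.refl _ _)⟩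
    · obtain ⟨x, rfl⟩ := hv.surjective i
      by_cases hx : (swap h k * f).SameCycle h x
      · exact ⟨k, by simp only [hnot, if_false]; rw [← hvhk, hinv _ _ hx]⟩
      · exact ⟨x, if_neg hx⟩
  · refine ⟨fun hxy => ?_, fun hxy => ?_⟩
    · by_cases hx : (swap h k * f).SameCycle h x <;> by_cases hy : (swap h k * f).SameCycle h y
      · exact hx.symm.trans hy
      · simp [hx, hy] at hxy
      · simp [hx, hy] at hxy
      · simp only [hx, hy, if_false, Option.some.injEq] at hxy
        have hs := (hv.eq_iff _ _).1 hxy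
        rcases sameCycle_swap_mul_of_sameCycle f h k hs with h1 | h1 | h1
        · exact h1
        · exact absurd h1 hy
        · rcases sameCycle_swap_mul_of_sameCycle f h k hs.symm with h2 | h2 | h2
          · exact h2.symm
          · exact absurd h2 hx
          · exact h2.symm.trans h1
    · have h1 : (swap h k * f).SameCycle h x ↔ (swap h k * f).SameCycle h y :=
        ⟨fun h => h.trans hxy, fun h => h.trans hxy.symm⟩
      simp only [h1, hinv _ _ hxy]

/-- Labelling the cycles after the cycles of `h` and `k` have been joined. -/
theorem IsCycleLabelling.swap_mul_of_ne (hv : f.IsCycleLabelling v) (hvhk : v h ≠ v k)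
    {W : Type*} {ι : W → V} (hι : Function.Injective ι) (hr : ∀ i, i ∈ Set.range ι ↔ i ≠ v k)
    {w : D → W} (hw : ∀ x, v x ≠ v k → ι (w x) = v x)
    (hw' : ∀ x, v x = v k → ι (w x) = v h) :
    (swap h k * f).IsCycleLabelling w := by
  have hsame := sameCycle_swap_mul_of_not_sameCycle fun hs => hvhk ((hv.eq_iff _ _).2 hs)
  have key : ∀ x y, f.SameCycle x y → (swap h k * f).SameCycle x y ∨
      (swap h k * f).SameCycle h y := fun x y hxy => by
    rcases sameCycle_swap_mul_of_sameCycle f h k hxy with h1 | h1 | h1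
    · exact Or.inl h1
    · exact Or.inr h1
    · exact Or.inr (hsame.trans h1)
  have keyh : ∀ x, v x = v h → (swap h k * f).SameCycle h x := fun x hx => by
    simpa using key _ _ ((hv.eq_iff _ _).1 hx.symm)
  have keyk : ∀ x, v x = v k → (swap h k * f).SameCycle h x := fun x hx => by
    rcases key _ _ ((hv.eq_iff _ _).1 hx.symm) with h1 | h1
    · exact hsame.trans h1
    · exact h1
  have hinv : ∀ x, w ((swap h k * f) x) = w x := fun x => hι (by
    rw [Perm.mul_apply, swap_apply_def]
    have hvx := hv.apply x
    split_ifs with h1 h2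
    · have : v x = v h := by rw [← hvx, h1]
      rw [hw' k rfl, hw x (this ▸ hvhk), this]
    · have : v x = v k := by rw [← hvx, h2]
      rw [hw h hvhk, hw' x this]
    · by_cases hx : v x = v k
      · rw [hw' _ hx, hw' _ (hvx.trans hx)]
      · rw [hw _ hx, hw _ (hvx ▸ hx), hvx])
  refine ⟨fun i => ?_, fun x y => ⟨fun hxy => ?_, fun hxy => hxy.eq_of_invariant hinv⟩⟩
  · obtain ⟨x, hx⟩ := hv.surjective (ι i)
    refine ⟨x, hι ?_⟩
    rw [hw _ (hx ▸ (hr _).1 ⟨i, rfl⟩), hx]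
  · have hxy' := congrArg ι hxy
    by_cases hx : v x = v k <;> by_cases hy : v y = v k
    · exact (keyk x hx).symm.trans (keyk y hy)
    · rw [hw' x hx, hw y hy] at hxy'
      exact (keyk x hx).symm.trans (keyh y hxy'.symm)
    · rw [hw x hx, hw' y hy] at hxy'
      exact (keyh x hxy').symm.trans (keyk y hy)
    · rw [hw x hx, hw y hy] at hxy'
      by_cases hh : v x = v h
      · exact (keyh x hh).symm.trans (keyh y (hxy' ▸ hh))
      · rcases key _ _ ((hv.eq_iff _ _).1 hxy') with h1 | h1
        · exact h1
        · rcases key _ _ ((hv.eq_iff _ _).1 hxy'.symm) with h2 | h2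
          · exact h2.symm
          · exact h2.symm.trans h1

theorem numCycles_swap_mul_of_sameCycle (hhk : h ≠ k) (hs : f.SameCycle h k) :
    (swap h k * f).numCycles = f.numCycles + 1 := by
  classical
  have hv := isCycleLabelling_mk f
  rw [(hv.swap_mul_of_eq hhk ((hv.eq_iff _ _).2 hs)).numCycles_eq, hv.numCycles_eq,
    Finite.card_option]

theorem numCycles_swap_mul_of_not_sameCycle (hs : ¬ f.SameCycle h k) :
    (swap h k * f).numCycles + 1 = f.numCycles := by
  have hhk : h ≠ k := fun hh => hs (hh ▸ SameCycle.refl _ _)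
  have h1 := sameCycle_swap_mul_of_not_sameCycle hs
  rw [← numCycles_swap_mul_of_sameCycle hhk h1, ← mul_assoc, swap_mul_self, one_mul]

end SwapMul

/-! ### First returns -/

section FirstReturn

variable [Finite D] (f : Perm D) (S : Set D)

theorem exists_pow_succ_notMem (x : {x // x ∉ S}) : ∃ n, (f ^ (n + 1)) x.1 ∉ S := by
  refine ⟨orderOf f - 1, ?_⟩
  rw [Nat.sub_add_cancel (orderOf_pos f), pow_orderOf_eq_one]
  exact x.2

open Classical in
theorem firstReturn_bijective :
    Function.Bijective fun x : {x // x ∉ S} =>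
      (⟨(f ^ (Nat.find (exists_pow_succ_notMem f S x) + 1)) x.1,
        Nat.find_spec (exists_pow_succ_notMem f S x)⟩ : {x // x ∉ S}) := by
  refine Finite.injective_iff_bijective.1 fun x y hxy => ?_
  have key : ∀ x y : {x // x ∉ S}, ∀ n m : ℕ, (∀ i < m, (f ^ (i + 1)) y.1 ∈ S) →
      (f ^ (n + 1)) x.1 = (f ^ (m + 1)) y.1 → n ≤ m → x = y := by
    intro x y n m hm h hnm
    obtain ⟨d, rfl⟩ := Nat.exists_eq_add_of_le hnm
    rw [show n + d + 1 = (n + 1) + d by ring, pow_add f (n + 1) d, Perm.mul_apply,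
      (f ^ (n + 1)).injective.eq_iff] at h
    rcases d with _ | d
    · exact Subtype.ext h
    · exact absurd (h ▸ hm d (by omega)) x.2
  have h := congrArg Subtype.val hxy
  rcases le_total (Nat.find (exists_pow_succ_notMem f S x))
    (Nat.find (exists_pow_succ_notMem f S y)) with hle | hle
  · exact key x y _ _ (fun i hi => not_not.1 (Nat.find_min _ hi)) h hle
  · exact (key y x _ _ (fun i hi => not_not.1 (Nat.find_min _ hi)) h.symm hle).symm

open Classical in
/-- The permutation induced by `f` outside `S`: the points of `S` are deleted from the cycles. -/
noncomputable def firstReturn : Perm {x // x ∉ S} :=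
  Equiv.ofBijective _ (firstReturn_bijective f S)

theorem firstReturn_spec (x : {x // x ∉ S}) :
    ∃ n, (∀ i < n, (f ^ (i + 1)) x.1 ∈ S) ∧ (f.firstReturn S x).1 = (f ^ (n + 1)) x.1 := by
  classical
  exact ⟨Nat.find (exists_pow_succ_notMem f S x), fun i hi => not_not.1 (Nat.find_min _ hi), rfl⟩

variable {f S}

theorem firstReturn_eq {x y : {x // x ∉ S}} {n : ℕ} (hn : ∀ i < n, (f ^ (i + 1)) x.1 ∈ S)
    (hy : y.1 = (f ^ (n + 1)) x.1) : f.firstReturn S x = y := by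
  obtain ⟨m, hm, h⟩ := firstReturn_spec f S x
  have hnm : n = m := by
    rcases lt_trichotomy n m with hlt | heq | hlt
    · exact absurd (hy ▸ hm n hlt) y.2
    · exact heq
    · exact absurd (h ▸ hn m hlt) (f.firstReturn S x).2
  subst hnm
  exact Subtype.ext (h.trans hy.symm)

theorem sameCycle_firstReturn {x y : {x // x ∉ S}} :
    (f.firstReturn S).SameCycle x y ↔ f.SameCycle x.1 y.1 := by
  constructor
  · intro h
    have := h.eq_of_invariant (v := fun z => Quotient.mk (SameCycle.setoid f) z.1) fun z => by
      obtain ⟨n, -, hn⟩ := firstReturn_spec f S z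
      rw [(isCycleLabelling_mk f).eq_iff, hn]
      exact sameCycle_pow_left.2 (SameCycle.refl _ _)
    exact ((isCycleLabelling_mk f).eq_iff _ _).1 this
  · intro h
    obtain ⟨n, hn⟩ := h.exists_nat_pow_eq
    clear h
    induction n using Nat.strong_induction_on generalizing x with
    | _ n ih =>
      rcases n with _ | n
      · rw [Subtype.ext hn]
      · obtain ⟨m, hm, hx⟩ := firstReturn_spec f S x
        have hmn : m ≤ n := by
          by_contra hlt
          exact y.2 (hn ▸ hm n (by omega))
        rw [← sameCycle_apply_left]
        refine ih (n - m) (by omega) ?_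
        rw [hx, ← Perm.mul_apply, ← pow_add, show n - m + (m + 1) = n + 1 by omega, hn]

/-- First returns of `f * s` when `s` moves only points outside `S`. -/
theorem firstReturn_mul {s : Perm D} (hs : ∀ x ∈ S, s x = x) (hs' : ∀ x, s x ∉ S ↔ x ∉ S) :
    (f * s).firstReturn S = f.firstReturn S * s.subtypePerm hs' := by
  ext x
  congr 1
  obtain ⟨n, hn, hx⟩ := firstReturn_spec f S (s.subtypePerm hs' x)
  have hpow : ∀ i ≤ n, ((f * s) ^ (i + 1)) x.1 = (f ^ (i + 1)) (s x.1) := by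
    intro i
    induction i with
    | zero => intro _; simp
    | succ i ih =>
      intro hi
      rw [pow_succ', Perm.mul_apply, ih (by omega), Perm.mul_apply,
        hs _ (by simpa using hn i (by omega)), pow_succ' f (i + 1), Perm.mul_apply]
  refine firstReturn_eq (n := n) (fun i hi => ?_) ?_
  · rw [hpow i hi.le]
    simpa using hn i hi
  · rw [hpow n le_rfl, Perm.mul_apply, hx]
    simp

/-- Every cycle of `f` either meets the complement of `S`, or consists of points of `S`. -/
theorem numCycles_eq_firstReturn_add {v : D → V} (hv : f.IsCycleLabelling v) :
    f.numCycles = (f.firstReturn S).numCycles +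
      Nat.card {i : V // ∀ x, x ∉ S → v x ≠ i} := by
  classical
  have : Finite V := Finite.of_surjective v hv.surjective
  have h1 : (f.firstReturn S).numCycles = Nat.card {i : V // ¬ ∀ x, x ∉ S → v x ≠ i} := by
    refine IsCycleLabelling.numCycles_eq (v := fun x => ⟨v x.1, fun h => h x.1 x.2 rfl⟩)
      ⟨?_, fun x y => ?_⟩
    · rintro ⟨i, hi⟩
      push Not at hi
      obtain ⟨x, hx, rfl⟩ := hi
      exact ⟨⟨x, hx⟩, rfl⟩
    · rw [Subtype.mk_eq_mk, hv.eq_iff, sameCycle_firstReturn]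
  rw [h1, hv.numCycles_eq, add_comm, ← Nat.card_sum]
  exact Nat.card_congr (Equiv.sumCompl _).symm

end FirstReturn

end Equiv.Perm

/-! ### Maps with marked darts -/

namespace MarkedMap

variable {D : Type*}

/-- `σ` is an involution whose fixed points are the points of `S`. -/
structure IsMatching (S : Set D) (σ : Perm D) : Prop where
  involutive : ∀ x, σ (σ x) = x
  fixed_iff : ∀ x, σ x = x ↔ x ∈ S

/-- Predicates that are constant on the orbits of the group generated by `ρ` and `σ`. -/
structure IsInvariant (ρ σ : Perm D) (P : D → Prop) : Prop where
  left : ∀ x, P (ρ x) ↔ P x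
  right : ∀ x, P (σ x) ↔ P x

/-- The group generated by `ρ` and `σ` acts transitively on the nonempty type `D`. -/
structure IsTransitive (ρ σ : Perm D) : Prop where
  nonempty : Nonempty D
  imp : ∀ P : D → Prop, IsInvariant ρ σ P → ∀ x y, P x → P y

/-- Twice the Euler characteristic of the surface on which `ρ`, `σ` is drawn. -/
noncomputable def twiceEuler (ρ : Perm D) (S : Set D) (σ : Perm D) : ℤ :=
  2 * ρ.numCycles + 2 * (ρ * σ).numCycles - Nat.card {x // x ∉ S}

/-- A connected map of genus `g`: the vertices are the cycles of `ρ`, the edges are the pairs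
`{x, σ x}` with `x` outside the set `S` of marked darts, and the faces are the cycles of `ρ σ`. -/
structure IsMap (g : ℕ) (ρ : Perm D) (S : Set D) (σ : Perm D) : Prop
    extends IsMatching S σ, IsTransitive ρ σ where
  euler : twiceEuler ρ S σ = 4 - 4 * (g : ℤ)

/-- The number of maps of genus `g` with given vertices and marked darts. -/
noncomputable def numMaps (g : ℕ) (ρ : Perm D) (S : Set D) : ℕ := Nat.card {σ // IsMap g ρ S σ}

theorem IsInvariant.not {ρ σ : Perm D} {P : D → Prop} (hP : IsInvariant ρ σ P) :
    IsInvariant ρ σ fun x => ¬ P x :=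
  ⟨fun x => not_congr (hP.left x), fun x => not_congr (hP.right x)⟩

theorem IsTransitive.subtypePerm {ρ σ : Perm D} {p : D → Prop} (hp : IsInvariant ρ σ p) {h k : D}
    (hT : ∀ P : D → Prop, IsInvariant ρ σ P → (P h ↔ P k) → ∀ x y, P x → P y)
    (hh : p h) (hk : ¬ p k) :
    IsTransitive (ρ.subtypePerm hp.left) (σ.subtypePerm hp.right) := by
  refine ⟨⟨⟨h, hh⟩⟩, fun Q hQ x y hx => ?_⟩
  have hQ' : IsInvariant ρ σ fun z => ∃ hz : p z, Q ⟨z, hz⟩ :=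
    ⟨fun z => ⟨fun ⟨hz, hz'⟩ => ⟨(hp.left z).1 hz, (hQ.left ⟨z, (hp.left z).1 hz⟩).1 hz'⟩,
      fun ⟨hz, hz'⟩ => ⟨(hp.left z).2 hz, (hQ.left ⟨z, hz⟩).2 hz'⟩⟩,
     fun z => ⟨fun ⟨hz, hz'⟩ => ⟨(hp.right z).1 hz, (hQ.right ⟨z, (hp.right z).1 hz⟩).1 hz'⟩,
      fun ⟨hz, hz'⟩ => ⟨(hp.right z).2 hz, (hQ.right ⟨z, hz⟩).2 hz'⟩⟩⟩
  by_cases hQh : Q ⟨h, hh⟩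
  · have := hT (fun z => (∃ hz : p z, Q ⟨z, hz⟩) ∨ ¬ p z)
      ⟨fun z => or_congr (hQ'.left z) (hp.not.left z),
        fun z => or_congr (hQ'.right z) (hp.not.right z)⟩
      ⟨fun _ => Or.inr hk, fun _ => Or.inl ⟨hh, hQh⟩⟩ x.1 y.1 (Or.inl ⟨x.2, hx⟩)
    rcases this with ⟨_, h1⟩ | h1
    · exact h1
    · exact absurd y.2 h1
  · obtain ⟨_, h1⟩ := hT _ hQ' ⟨fun ⟨_, h2⟩ => absurd h2 hQh, fun ⟨h2, _⟩ => absurd h2 hk⟩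
      x.1 h ⟨x.2, hx⟩
    exact absurd h1 hQh

section Swap

variable [DecidableEq D] {ρ σ : Perm D} {S : Set D} {h k : D}

theorem isInvariant_swap_iff {P : D → Prop} (hP : P h ↔ P k) :
    IsInvariant (swap h k * ρ) (σ * swap h k) P ↔ IsInvariant ρ σ P := by
  have hs : ∀ x, P (swap h k x) ↔ P x := fun x => by
    rw [swap_apply_def]
    split_ifs with h1 h2
    · rw [h1, hP]
    · rw [h2, hP]
    · rfl
  refine ⟨fun hI => ⟨fun x => ?_, fun x => ?_⟩, fun hI => ⟨fun x => ?_, fun x => ?_⟩⟩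
  · rw [← hI.left x, Perm.mul_apply, hs]
  · rw [← hs x, ← hI.right (swap h k x), Perm.mul_apply, swap_apply_self]
  · rw [Perm.mul_apply, hs, hI.left]
  · rw [Perm.mul_apply, hI.right, hs]

theorem isMatching_swap_iff (hhk : h ≠ k) (hh : h ∉ S) (hk : k ∉ S) :
    IsMatching (insert h (insert k S)) (σ * swap h k) ↔ IsMatching S σ ∧ σ h = k := by
  have hne : ∀ x, x ≠ h → x ≠ k → (σ * swap h k) x = σ x := fun x h1 h2 => by
    rw [Perm.mul_apply, swap_apply_of_ne_of_ne h1 h2]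
  have hl : (σ * swap h k) h = σ k := by rw [Perm.mul_apply, swap_apply_left]
  have hr : (σ * swap h k) k = σ h := by rw [Perm.mul_apply, swap_apply_right]
  constructor
  · rintro ⟨h1, h2⟩
    have hσk : σ k = h := hl ▸ (h2 h).2 (Set.mem_insert _ _)
    have hσh : σ h = k := hr ▸ (h2 k).2 (Set.mem_insert_of_mem _ (Set.mem_insert _ _))
    refine ⟨⟨fun x => ?_, fun x => ?_⟩, hσh⟩
    · by_cases hxh : x = h
      · rw [hxh, hσh, hσk]
      by_cases hxk : x = k
      · rw [hxk, hσk, hσh]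
      have h3 := h1 x
      rw [hne x hxh hxk, hne] at h3
      · exact h3
      · rw [← hσk]; exact fun h => hxk (σ.injective h)
      · rw [← hσh]; exact fun h => hxh (σ.injective h)
    · by_cases hxh : x = h
      · rw [hxh, hσh]
        simp [hhk.symm, hh]
      by_cases hxk : x = k
      · rw [hxk, hσk]
        simp [hhk, hk]
      rw [← hne x hxh hxk, h2]
      simp [hxh, hxk]
  · rintro ⟨⟨h1, h2⟩, hσh⟩
    have hσk : σ k = h := by rw [← hσh, h1]
    refine ⟨fun x => ?_, fun x => ?_⟩
    · by_cases hxh : x = h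
      · rw [hxh, hl, hσk, hl, hσk]
      by_cases hxk : x = k
      · rw [hxk, hr, hσh, hr, hσh]
      rw [hne x hxh hxk, hne, h1]
      · rw [← hσk]; exact fun h => hxk (σ.injective h)
      · rw [← hσh]; exact fun h => hxh (σ.injective h)
    · by_cases hxh : x = h
      · rw [hxh, hl, hσk]
        simp
      by_cases hxk : x = k
      · rw [hxk, hr, hσh]
        simp
      rw [hne x hxh hxk, h2]
      simp [hxh, hxk]

variable [Finite D]

theorem isTransitive_swap_iff (hσ : σ h = k) (hs : ¬ ρ.SameCycle h k) :
    IsTransitive (swap h k * ρ) (σ * swap h k) ↔ IsTransitive ρ σ := by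
  refine ⟨fun hT => ⟨⟨h⟩, fun P hP => hT.imp P ((isInvariant_swap_iff ?_).2 hP)⟩,
    fun hT => ⟨⟨h⟩, fun P hP => hT.imp P ((isInvariant_swap_iff ?_).1 hP)⟩⟩
  · rw [← hσ, hP.right]
  · exact Eq.to_iff ((sameCycle_swap_mul_of_not_sameCycle hs).eq_of_invariant
      fun x => propext (hP.left x))

omit [Finite D] in
theorem isTransitive_iff_swap (hσ : σ h = k) :
    IsTransitive ρ σ ↔ IsTransitive (swap h k * ρ) (σ * swap h k) ∨
      ∃ (p : D → Prop) (hp : IsInvariant (swap h k * ρ) (σ * swap h k) p), p h ∧ ¬ p k ∧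
        IsTransitive ((swap h k * ρ).subtypePerm hp.left) ((σ * swap h k).subtypePerm hp.right) ∧
        IsTransitive ((swap h k * ρ).subtypePerm (p := fun x => ¬ p x) hp.not.left)
          ((σ * swap h k).subtypePerm (p := fun x => ¬ p x) hp.not.right) := by
  constructor
  · intro hT
    by_contra! hcon
    obtain ⟨h1, h2⟩ := hcon
    refine h1 ⟨⟨h⟩, fun P hP x y hx => ?_⟩
    have hT' : ∀ P : D → Prop, IsInvariant (swap h k * ρ) (σ * swap h k) P → (P h ↔ P k) →
        ∀ x y, P x → P y := fun P hP hhk => hT.imp P ((isInvariant_swap_iff hhk).1 hP)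
    have key : ∀ p : D → Prop, IsInvariant (swap h k * ρ) (σ * swap h k) p → p h → p k := by
      intro p hp hph
      by_contra hpk
      exact h2 p hp hph hpk (IsTransitive.subtypePerm hp hT' hph hpk)
        (IsTransitive.subtypePerm hp.not (fun P hP hhk => hT' P hP hhk.symm) hpk (not_not.2 hph))
    exact hT' P hP ⟨key P hP, not_imp_not.1 (key _ hP.not)⟩ x y hx
  · rintro (hT | ⟨p, hp, hph, hpk, hT1, hT2⟩) <;> refine ⟨⟨h⟩, fun P hP x y hx => ?_⟩
    · refine hT.imp P ((isInvariant_swap_iff ?_).2 hP) x y hx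
      rw [← hσ, hP.right]
    · have hhk : P h ↔ P k := by rw [← hσ, hP.right]
      have hP' := (isInvariant_swap_iff hhk).2 hP
      have c1 : ∀ x y, p x → p y → P x → P y := fun x y hx hy hPx =>
        hT1.imp (fun z => P z.1) ⟨fun z => hP'.left z.1, fun z => hP'.right z.1⟩
          ⟨x, hx⟩ ⟨y, hy⟩ hPx
      have c2 : ∀ x y, ¬ p x → ¬ p y → P x → P y := fun x y hx hy hPx =>
        hT2.imp (fun z => P z.1) ⟨fun z => hP'.left z.1, fun z => hP'.right z.1⟩
          ⟨x, hx⟩ ⟨y, hy⟩ hPx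
      by_cases hpx : p x <;> by_cases hpy : p y
      · exact c1 x y hpx hpy hx
      · exact c2 k y hpk hpy (hhk.1 (c1 x h hpx hph hx))
      · exact c1 h y hph hpy (hhk.2 (c2 x k hpx hpk hx))
      · exact c2 x y hpx hpy hx

theorem card_notMem_insert_insert {p : D → Prop} (hhk : h ≠ k) (hh : h ∉ S) (hk : k ∉ S)
    (hph : p h) (hpk : p k) :
    Nat.card {x // p x ∧ x ∉ insert h (insert k S)} + 2 = Nat.card {x // p x ∧ x ∉ S} := by
  have : {x | p x ∧ x ∉ S} = insert h (insert k {x | p x ∧ x ∉ insert h (insert k S)}) := by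
    ext x
    by_cases hxh : x = h <;> by_cases hxk : x = k <;> simp_all
  change _ = ({x | p x ∧ x ∉ S}).ncard
  rw [this, Set.ncard_insert_of_notMem (by simp [hhk]), Set.ncard_insert_of_notMem (by simp)]
  rfl

omit [Finite D] in
theorem numCycles_swap (ρ σ : Perm D) :
    (swap h k * ρ * (σ * swap h k)).numCycles = (ρ * σ).numCycles :=
  (numCycles_congr (swap h k) fun x => by simp).symm

theorem twiceEuler_swap_of_not_sameCycle (hh : h ∉ S) (hk : k ∉ S) (hs : ¬ ρ.SameCycle h k) :
    twiceEuler (swap h k * ρ) (insert h (insert k S)) (σ * swap h k) = twiceEuler ρ S σ := by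
  have h1 := numCycles_swap_mul_of_not_sameCycle hs
  have hhk : h ≠ k := fun e => hs (e ▸ SameCycle.refl _ _)
  have h2 := card_notMem_insert_insert (S := S) (p := fun _ => True) hhk hh hk trivial trivial
  simp only [true_and] at h2
  rw [twiceEuler, twiceEuler, numCycles_swap, ← h1, ← h2]
  push_cast
  ring

theorem twiceEuler_swap_of_sameCycle (hhk : h ≠ k) (hh : h ∉ S) (hk : k ∉ S)
    (hs : ρ.SameCycle h k) :
    twiceEuler (swap h k * ρ) (insert h (insert k S)) (σ * swap h k) = twiceEuler ρ S σ + 4 := by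
  have h1 := numCycles_swap_mul_of_sameCycle hhk hs
  have h2 := card_notMem_insert_insert (S := S) (p := fun _ => True) hhk hh hk trivial trivial
  simp only [true_and] at h2
  rw [twiceEuler, twiceEuler, numCycles_swap, h1, ← h2]
  push_cast
  ring

end Swap

section Split

variable [Finite D] {ρ σ : Perm D} {S : Set D} {p : D → Prop}

theorem twiceEuler_eq_add (hp : IsInvariant ρ σ p) :
    twiceEuler ρ S σ =
      twiceEuler (ρ.subtypePerm hp.left) (Subtype.val ⁻¹' S) (σ.subtypePerm hp.right) +
      twiceEuler (ρ.subtypePerm (p := fun x => ¬ p x) hp.not.left) (Subtype.val ⁻¹' S)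
        (σ.subtypePerm (p := fun x => ¬ p x) hp.not.right) := by
  classical
  have h1 : Nat.card {x // x ∉ S} = Nat.card {x : {x // p x} // x ∉ Subtype.val ⁻¹' S} +
      Nat.card {x : {x // ¬ p x} // x ∉ Subtype.val ⁻¹' S} := by
    rw [← Nat.card_sum]
    refine Nat.card_congr ((Equiv.sumCompl fun x : {x // x ∉ S} => p x.1).symm.trans
      (Equiv.sumCongr ?_ ?_)) <;>
    exact ⟨fun x => ⟨⟨x.1.1, x.2⟩, x.1.2⟩, fun x => ⟨⟨x.1.1, x.2⟩, x.1.2⟩, fun _ => rfl,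
      fun _ => rfl⟩
  rw [twiceEuler, twiceEuler, twiceEuler, h1, numCycles_eq_add ρ hp.left hp.not.left,
    subtypePerm_mul, subtypePerm_mul, numCycles_eq_add (ρ * σ)
      (fun x => (hp.left _).trans (hp.right x)) (fun x => (hp.not.left _).trans (hp.not.right x))]
  push_cast
  ring

omit [Finite D] in
theorem IsMatching.subtypePerm (hσ : IsMatching S σ) (hp : ∀ x, p (σ x) ↔ p x) :
    IsMatching (Subtype.val ⁻¹' S) (σ.subtypePerm hp) :=
  ⟨fun x => Subtype.ext (hσ.involutive x.1), fun x => by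
    rw [Subtype.ext_iff]; exact hσ.fixed_iff x.1⟩

end Split

theorem numCycles_eq_one [Finite D] {ρ : Perm D} (hT : IsTransitive ρ 1) : ρ.numCycles = 1 := by
  rw [IsCycleLabelling.numCycles_eq (v := fun _ : D => ())]
  · simp
  · have := hT.nonempty
    refine ⟨fun _ => ⟨Classical.arbitrary D, rfl⟩, fun x y => ⟨fun _ => ?_, fun _ => rfl⟩⟩
    exact hT.imp (fun z => ρ.SameCycle x z)
      ⟨fun z => sameCycle_apply_right, fun z => Iff.rfl⟩ x y (SameCycle.refl _ _)

/-- Every connected map has a genus. -/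
theorem exists_twiceEuler_eq [Finite D] {ρ σ : Perm D} {S : Set D} (hσ : IsMatching S σ)
    (hT : IsTransitive ρ σ) : ∃ g : ℕ, twiceEuler ρ S σ = 4 - 4 * (g : ℤ) := by
  classical
  obtain ⟨m, hm⟩ : ∃ m, Nat.card {x // x ∉ S} = m := ⟨_, rfl⟩
  induction m using Nat.strong_induction_on generalizing D with
  | _ m ih =>
    by_cases hS : ∃ h, h ∉ S
    · obtain ⟨h, hh⟩ := hS
      obtain ⟨k, hk⟩ : ∃ k, σ h = k := ⟨_, rfl⟩
      have hhk : h ≠ k := fun e => hh ((hσ.fixed_iff h).1 (hk.trans e.symm))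
      have hkS : k ∉ S := fun e => hhk (by
        rw [← hσ.involutive h, hk, (hσ.fixed_iff k).2 e])
      have hσ' := (isMatching_swap_iff (S := S) hhk hh hkS).2 ⟨hσ, hk⟩
      have hcard := card_notMem_insert_insert (S := S) (p := fun _ => True) hhk hh hkS
        trivial trivial
      simp only [true_and] at hcard
      by_cases hs : ρ.SameCycle h k
      · have he := twiceEuler_swap_of_sameCycle (σ := σ) hhk hh hkS hs
        rcases (isTransitive_iff_swap hk).1 hT with hT' | ⟨p, hp, hph, hpk, hT1, hT2⟩
        · obtain ⟨g, hg⟩ := ih _ (by omega) hσ' hT' rfl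
          exact ⟨g + 1, by push_cast; linarith⟩
        · have hle : ∀ q : D → Prop, Nat.card {x : {x // q x} //
              x ∉ Subtype.val ⁻¹' (insert h (insert k S))} ≤
              Nat.card {x // x ∉ insert h (insert k S)} := fun q =>
            Nat.card_le_card_of_injective (fun x => ⟨x.1.1, x.2⟩) fun x y hxy =>
              Subtype.ext (Subtype.ext (Subtype.mk.inj hxy))
          obtain ⟨g₁, hg₁⟩ := ih _ (by have := hle p; omega) (hσ'.subtypePerm hp.right) hT1 rfl
          obtain ⟨g₂, hg₂⟩ := ih _ (by have := hle fun x => ¬ p x; omega)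
            (hσ'.subtypePerm hp.not.right) hT2 rfl
          have hadd := twiceEuler_eq_add (S := insert h (insert k S)) hp
          exact ⟨g₁ + g₂, by push_cast; linarith⟩
      · obtain ⟨g, hg⟩ := ih _ (by omega) hσ' ((isTransitive_swap_iff hk hs).2 hT) rfl
        exact ⟨g, by rw [← hg, twiceEuler_swap_of_not_sameCycle hh hkS hs]⟩
    · push Not at hS
      have h1 : σ = 1 := Perm.ext fun x => (hσ.fixed_iff x).2 (hS x)
      subst h1
      have : IsEmpty {x // x ∉ S} := ⟨fun x => x.2 (hS x.1)⟩
      refine ⟨0, ?_⟩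
      rw [twiceEuler, mul_one, numCycles_eq_one hT]
      simp

/-! ### Removing an edge -/

theorem card_subtype_eq_sum {X ι : Type*} [Finite X] {P : X → Prop} (s : Finset ι)
    {Q : ι → X → Prop} (h : ∀ x, P x ↔ ∃ i ∈ s, Q i x)
    (huniq : ∀ x, ∀ i ∈ s, ∀ j ∈ s, Q i x → Q j x → i = j) :
    Nat.card {x // P x} = ∑ i ∈ s, Nat.card {x // Q i x} := by
  rw [← Finset.sum_coe_sort, ← Nat.card_sigma]
  refine (Nat.card_eq_of_bijective
    (fun y : Σ i : s, {x // Q i x} => (⟨y.2.1, (h _).2 ⟨y.1, y.1.2, y.2.2⟩⟩ : {x // P x}))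
    ⟨?_, fun x => ?_⟩).symm
  · rintro ⟨⟨i, hi⟩, x, hx⟩ ⟨⟨j, hj⟩, y, hy⟩ hxy
    obtain rfl : x = y := congrArg Subtype.val hxy
    obtain rfl := huniq x i hi j hj hx hy
    rfl
  · obtain ⟨i, hi, hQ⟩ := (h x.1).1 x.2
    exact ⟨⟨⟨i, hi⟩, x.1, hQ⟩, rfl⟩

section Swap

variable [DecidableEq D] [Finite D] {ρ : Perm D} {S : Set D} {h k : D}

/-- Contracting the edge `{h, k}` between two different vertices. -/
theorem card_isMap_of_not_sameCycle (g : ℕ) (hh : h ∉ S) (hk : k ∉ S)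
    (hs : ¬ ρ.SameCycle h k) :
    Nat.card {σ // IsMap g ρ S σ ∧ σ h = k} =
      numMaps g (swap h k * ρ) (insert h (insert k S)) := by
  have hhk : h ≠ k := fun e => hs (e ▸ SameCycle.refl _ _)
  refine Nat.card_congr ((Equiv.mulRight (swap h k)).subtypeEquiv fun σ => ?_)
  rw [Equiv.coe_mulRight]
  constructor
  · rintro ⟨hσ, hσh⟩
    exact ⟨(isMatching_swap_iff hhk hh hk).2 ⟨hσ.toIsMatching, hσh⟩,
      (isTransitive_swap_iff hσh hs).2 hσ.toIsTransitive,
      by rw [twiceEuler_swap_of_not_sameCycle hh hk hs, hσ.euler]⟩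
  · intro hσ
    obtain ⟨h1, h2⟩ := (isMatching_swap_iff hhk hh hk).1 hσ.toIsMatching
    exact ⟨⟨h1, (isTransitive_swap_iff h2 hs).1 hσ.toIsTransitive,
      by rw [← hσ.euler, twiceEuler_swap_of_not_sameCycle hh hk hs]⟩, h2⟩

/-- Maps with two components, of genera `g₁` and `g₂`, on the complementary sets of darts `p` and
`¬ p`. -/
structure IsPairOfMaps (g₁ g₂ : ℕ) (ρ : Perm D) (S : Set D) (p : D → Prop) (σ : Perm D) :
    Prop where
  invariant : IsInvariant ρ σ p
  left : IsMap g₁ (ρ.subtypePerm invariant.left) (Subtype.val ⁻¹' S)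
    (σ.subtypePerm invariant.right)
  right : IsMap g₂ (ρ.subtypePerm (p := fun x => ¬ p x) invariant.not.left) (Subtype.val ⁻¹' S)
    (σ.subtypePerm (p := fun x => ¬ p x) invariant.not.right)

omit [DecidableEq D] [Finite D] in
theorem card_isPairOfMaps (g₁ g₂ : ℕ) {p : D → Prop} (hp : ∀ x, p (ρ x) ↔ p x)
    (hp' : ∀ x, ¬ p (ρ x) ↔ ¬ p x) :
    Nat.card {σ // IsPairOfMaps g₁ g₂ ρ S p σ} =
      numMaps g₁ (ρ.subtypePerm hp) (Subtype.val ⁻¹' S) *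
        numMaps g₂ (ρ.subtypePerm (p := fun x => ¬ p x) hp') (Subtype.val ⁻¹' S) := by
  classical
  rw [numMaps, numMaps, ← Nat.card_prod]
  refine Nat.card_eq_of_bijective (fun σ => (⟨_, σ.2.left⟩, ⟨_, σ.2.right⟩)) ⟨?_, ?_⟩
  · rintro ⟨σ, hσ⟩ ⟨τ, hτ⟩ heq
    simp only [Prod.mk.injEq, Subtype.mk.injEq] at heq
    refine Subtype.ext (Perm.ext fun x => ?_)
    by_cases hx : p x
    · exact congrArg Subtype.val (Equiv.congr_fun heq.1 ⟨x, hx⟩)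
    · exact congrArg Subtype.val (Equiv.congr_fun heq.2 ⟨x, hx⟩)
  · rintro ⟨⟨σ, hσ⟩, τ, hτ⟩
    have hl : ∀ x (hx : p x), σ.subtypeCongr τ x = σ ⟨x, hx⟩ := fun x hx =>
      Perm.subtypeCongr.left_apply _ _ hx
    have hr : ∀ x (hx : ¬ p x), σ.subtypeCongr τ x = τ ⟨x, hx⟩ := fun x hx =>
      Perm.subtypeCongr.right_apply _ _ hx
    have hinv : IsInvariant ρ (σ.subtypeCongr τ) p := ⟨hp, fun x => by
      by_cases hx : p x
      · simp only [hl x hx, hx, (σ ⟨x, hx⟩).2]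
      · simp only [hr x hx, hx, (τ ⟨x, hx⟩).2]⟩
    have e1 : (σ.subtypeCongr τ).subtypePerm hinv.right = σ :=
      Perm.ext fun x => Subtype.ext (hl x.1 x.2)
    have e2 : (σ.subtypeCongr τ).subtypePerm (p := fun x => ¬ p x) hinv.not.right = τ :=
      Perm.ext fun x => Subtype.ext (hr x.1 x.2)
    exact ⟨⟨σ.subtypeCongr τ, hinv, by rwa [e1], by rwa [e2]⟩,
      Prod.ext (Subtype.ext e1) (Subtype.ext e2)⟩

/-- Removing the loop `{h, k}`: the surface stays connected and loses a handle, or falls into two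
components. -/
theorem isMap_iff_of_sameCycle (g : ℕ) (hhk : h ≠ k) (hh : h ∉ S) (hk : k ∉ S)
    (hs : ρ.SameCycle h k) {σ : Perm D} :
    (IsMap g ρ S σ ∧ σ h = k) ↔
      (0 < g ∧ IsMap (g - 1) (swap h k * ρ) (insert h (insert k S)) (σ * swap h k)) ∨
      ∃ (p : D → Prop) (q : ℕ × ℕ), p h ∧ ¬ p k ∧ q.1 + q.2 = g ∧
        IsPairOfMaps q.1 q.2 (swap h k * ρ) (insert h (insert k S)) p (σ * swap h k) := by
  have he := twiceEuler_swap_of_sameCycle (σ := σ) hhk hh hk hs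
  constructor
  · rintro ⟨hσ, hσh⟩
    have hm := (isMatching_swap_iff hhk hh hk).2 ⟨hσ.toIsMatching, hσh⟩
    have he' := hσ.euler
    rcases (isTransitive_iff_swap hσh).1 hσ.toIsTransitive with hT | ⟨p, hp, hph, hpk, hT1, hT2⟩
    · obtain ⟨g', hg'⟩ := exists_twiceEuler_eq hm hT
      obtain rfl : g = g' + 1 := by omega
      exact Or.inl ⟨g'.succ_pos, hm, hT, by rw [hg', Nat.add_sub_cancel]⟩
    · obtain ⟨g₁, hg₁⟩ := exists_twiceEuler_eq (hm.subtypePerm hp.right) hT1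
      obtain ⟨g₂, hg₂⟩ := exists_twiceEuler_eq (hm.subtypePerm hp.not.right) hT2
      have hadd := twiceEuler_eq_add (S := insert h (insert k S)) hp
      exact Or.inr ⟨p, (g₁, g₂), hph, hpk, by dsimp only; omega, hp,
        ⟨hm.subtypePerm _, hT1, hg₁⟩, hm.subtypePerm _, hT2, hg₂⟩
  · rintro (⟨hg, hσ⟩ | ⟨p, q, hph, hpk, hq, hp, h1, h2⟩)
    · obtain ⟨hm, hσh⟩ := (isMatching_swap_iff hhk hh hk).1 hσ.toIsMatching
      refine ⟨⟨hm, (isTransitive_iff_swap hσh).2 (Or.inl hσ.toIsTransitive), ?_⟩, hσh⟩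
      have he' := hσ.euler
      omega
    · have hm : IsMatching (insert h (insert k S)) (σ * swap h k) := by
        refine ⟨fun x => ?_, fun x => ?_⟩
        · by_cases hx : p x
          · exact congrArg Subtype.val (h1.involutive ⟨x, hx⟩)
          · exact congrArg Subtype.val (h2.involutive ⟨x, hx⟩)
        · by_cases hx : p x
          · exact Subtype.ext_iff.symm.trans (h1.fixed_iff ⟨x, hx⟩)
          · exact Subtype.ext_iff.symm.trans (h2.fixed_iff ⟨x, hx⟩)
      obtain ⟨hm, hσh⟩ := (isMatching_swap_iff hhk hh hk).1 hm
      refine ⟨⟨hm, (isTransitive_iff_swap hσh).2 (Or.inr ⟨p, hp, hph, hpk, h1.toIsTransitive,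
        h2.toIsTransitive⟩), ?_⟩, hσh⟩
      have hadd := twiceEuler_eq_add (S := insert h (insert k S)) hp
      have e1 := h1.euler
      have e2 := h2.euler
      omega

end Swap

end MarkedMap

/-! ### Counting arrowed cell graphs by counting involutions -/

namespace Equiv.Perm

theorem pow_apply_eq_pow_apply_iff_modEq {H V : Type*} [Finite H] {r : Perm H} {v : H → V}
    (hv : ∀ x y, v x = v y ↔ r.SameCycle x y) (a : H) (m n : ℕ) :
    (r ^ m) a = (r ^ n) a ↔ m ≡ n [MOD Nat.card {x // v x = v a}] := by
  classical
  have := Fintype.ofFinite H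
  have hc : r.IsCycleOn ({x | v x = v a} : Finset H) := by
    refine ⟨⟨fun x hx => ?_, r.injective.injOn, fun x hx => ⟨r.symm x, ?_, by simp⟩⟩,
      fun x hx y hy => ?_⟩
    · simp only [Finset.coe_filter, Finset.mem_univ, true_and, Set.mem_ofPred_eq] at hx ⊢
      rw [← hx, hv, sameCycle_apply_left]
    · simp only [Finset.coe_filter, Finset.mem_univ, true_and, Set.mem_ofPred_eq] at hx ⊢
      rw [← hx, hv, sameCycle_symm_apply_left]
    · simp only [Finset.coe_filter, Finset.mem_univ, true_and, Set.mem_ofPred_eq] at hx hy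
      rw [← hv, hx, hy]
  rw [hc.pow_apply_eq_pow_apply (by simp), Nat.card_eq_fintype_card, Fintype.card_subtype]

/-- Two permutations with labelled cycles of the same lengths, and with a base point on each
cycle, are conjugate by a unique bijection. -/
theorem exists_equiv_of_card_eq {H H' V : Type*} [Finite H] [Finite H'] {r : Perm H}
    {r' : Perm H'} {v : H → V} {v' : H' → V} (hv : ∀ x y, v x = v y ↔ r.SameCycle x y)
    (hv' : ∀ x y, v' x = v' y ↔ r'.SameCycle x y)
    (hcard : ∀ i, Nat.card {x // v x = i} = Nat.card {x // v' x = i}) {A : Set H} {A' : Set H'}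
    (hA : ∀ x, ∃! a, a ∈ A ∧ v a = v x) (hA' : ∀ x, ∃! a, a ∈ A' ∧ v' a = v' x) :
    ∃ f : H ≃ H', (∀ x, f (r x) = r' (f x)) ∧ (∀ x, v' (f x) = v x) ∧
      ∀ x, f x ∈ A' ↔ x ∈ A := by
  have hex : ∀ x, ∃ y, v' y = v x := fun x => by
    have : Finite {y // v y = v x} := inferInstance
    have h0 : 0 < Nat.card {y // v y = v x} := Nat.card_pos_iff.2 ⟨⟨⟨x, rfl⟩⟩, inferInstance⟩
    rw [hcard] at h0
    obtain ⟨⟨⟨y, hy⟩⟩, -⟩ := Nat.card_pos_iff.1 h0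
    exact ⟨y, hy⟩
  have hex' : ∀ y, ∃ x, v x = v' y := fun y => by
    have h0 : 0 < Nat.card {x // v' x = v' y} := Nat.card_pos_iff.2 ⟨⟨⟨y, rfl⟩⟩, inferInstance⟩
    rw [← hcard] at h0
    obtain ⟨⟨⟨x, hx⟩⟩, -⟩ := Nat.card_pos_iff.1 h0
    exact ⟨x, hx⟩
  have hb' : ∀ x, ∃ b, b ∈ A' ∧ v' b = v x := fun x => by
    obtain ⟨y, hy⟩ := hex x
    obtain ⟨b, hb, -⟩ := hA' y
    exact ⟨b, hb.1, hb.2.trans hy⟩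
  choose a ha haA using fun x => (hA x).exists
  choose b hb hbv using hb'
  have hau : ∀ x y, v x = v y → a x = a y := fun x y hxy =>
    (hA x).unique ⟨ha x, haA x⟩ ⟨ha y, (haA y).trans hxy.symm⟩
  have hbu : ∀ x y, v x = v y → b x = b y := fun x y hxy =>
    (hA' (b x)).unique ⟨hb x, rfl⟩ ⟨hb y, by rw [hbv, hbv, hxy]⟩
  choose n hn using fun x => ((hv _ _).1 (haA x)).exists_nat_pow_eq
  have key : ∀ x k l, (r ^ k) (a x) = (r ^ l) (a x) ↔ (r' ^ k) (b x) = (r' ^ l) (b x) := by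
    intro x k l
    rw [pow_apply_eq_pow_apply_iff_modEq hv, pow_apply_eq_pow_apply_iff_modEq hv', hcard, haA, hbv]
  have hvf : ∀ x, v' ((r' ^ n x) (b x)) = v x := fun x => by
    rw [← hbv x, hv']
    exact sameCycle_pow_left.2 (SameCycle.refl _ _)
  have hbij : Function.Bijective fun x => (r' ^ n x) (b x) := by
    constructor
    · intro x y hxy
      have hvxy : v x = v y := by rw [← hvf x, ← hvf y]; exact congrArg v' hxy
      dsimp only at hxy
      rw [← hbu x y hvxy, ← key, hn, hau x y hvxy, hn] at hxy
      exact hxy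
    · intro y
      obtain ⟨x, hx⟩ := hex' y
      obtain ⟨m, hm⟩ := ((hv' (b x) y).1 ((hbv x).trans hx)).exists_nat_pow_eq
      have hvx : v ((r ^ m) (a x)) = v x := by
        rw [← haA x, hv]
        exact sameCycle_pow_left.2 (SameCycle.refl _ _)
      refine ⟨(r ^ m) (a x), ?_⟩
      dsimp only
      rw [hbu _ x hvx, ← hm, ← key]
      have h1 := hn ((r ^ m) (a x))
      rwa [hau _ x hvx] at h1
  refine ⟨Equiv.ofBijective _ hbij, fun x => ?_, hvf, fun x => ?_⟩
  · have hvx : v (r x) = v x := (hv _ _).2 (sameCycle_apply_left.2 (SameCycle.refl _ _))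
    simp only [Equiv.ofBijective_apply]
    rw [hbu _ x hvx, ← Perm.mul_apply, ← pow_succ', ← key]
    conv_lhs => rw [← hau _ x hvx]
    rw [hn, pow_succ', Perm.mul_apply, hn]
  · simp only [Equiv.ofBijective_apply]
    constructor
    · intro hx
      have h1 : (r' ^ n x) (b x) = (r' ^ 0) (b x) :=
        (hA' (b x)).unique ⟨hx, by rw [hvf, hbv]⟩ ⟨hb x, rfl⟩
      rw [← key, hn] at h1
      rw [h1]
      exact ha x
    · intro hx
      have h1 : a x = x := (hA x).unique ⟨ha x, haA x⟩ ⟨hx, rfl⟩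
      have h2 : (r ^ n x) (a x) = (r ^ 0) (a x) := by rw [hn, h1]; rfl
      rw [key] at h2
      rw [h2]
      exact hb x

theorem sameCycle_iff_of_eqOn {D : Type*} [Finite D] {f g : Perm D} {S : Set D}
    (hfg : ∀ x ∈ S, f x = g x) {x y : D} (hx : ∀ y, f.SameCycle x y → y ∈ S) :
    f.SameCycle x y ↔ g.SameCycle x y := by
  constructor <;> intro h <;> obtain ⟨n, rfl⟩ := h.exists_nat_pow_eq <;> clear h
  · induction n with
    | zero => exact SameCycle.refl _ _
    | succ n ih =>
      rw [pow_succ', Perm.mul_apply, hfg _ (hx _ (sameCycle_pow_right.2 (SameCycle.refl _ _))),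
        sameCycle_apply_right]
      exact ih
  · induction n with
    | zero => exact SameCycle.refl _ _
    | succ n ih =>
      rw [pow_succ', Perm.mul_apply, ← hfg _ (hx _ ih), sameCycle_apply_right]
      exact ih

/-- A bijection that commutes with a permutation and fixes a point of each cycle is trivial. -/
theorem apply_eq_self_of_commute {H : Type*} [Finite H] {r : Perm H} {f : H → H}
    (hf : ∀ x, f (r x) = r (f x)) {a x : H} (ha : f a = a) (hax : r.SameCycle a x) : f x = x := by
  obtain ⟨n, rfl⟩ := hax.exists_nat_pow_eq
  clear hax
  induction n with
  | zero => exact ha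
  | succ n ih => rw [pow_succ', Perm.mul_apply, hf, ih]

end Equiv.Perm

theorem CellGraph.isConnectedOfGenus_of_equiv {V : Type} {Γ Γ' : CellGraph V}
    (f : Γ.HalfEdge ≃ Γ'.HalfEdge) (hr : ∀ h, f (Γ.rot h) = Γ'.rot (f h))
    (hf : ∀ h, f (Γ.flip h) = Γ'.flip (f h)) (hv : ∀ h, Γ'.vertex (f h) = Γ.vertex h) {g : ℕ}
    (h : Γ.IsConnectedOfGenus g) : Γ'.IsConnectedOfGenus g := by
  obtain ⟨h1, h2⟩ := h
  refine ⟨?_, ?_⟩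
  · unfold CellGraph.Connected at h1 ⊢
    convert h1 using 5 with i j
    refine ⟨fun ⟨x, hx, hx'⟩ => ⟨f.symm x, ?_, ?_⟩, fun ⟨x, hx, hx'⟩ => ⟨f x, ?_, ?_⟩⟩
    · rw [← hv, f.apply_symm_apply, hx]
    · rw [← hv, hf, f.apply_symm_apply, hx']
    · rw [hv, hx]
    · rw [← hf, hv, hx']
  · have e1 : Γ.numEdges = Γ'.numEdges := numCycles_congr f hf
    have e2 : Γ.numFaces = Γ'.numFaces := by
      refine congrArg₂ _ (numCycles_congr f fun x => ?_) (Nat.card_congr (Equiv.subtypeEquivRight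
        fun i => f.forall_congr fun x => ?_))
      · rw [Perm.mul_apply, hr, hf, Perm.mul_apply]
      · rw [hv]
    rw [← e1, ← e2, h2]

namespace MarkedMap

variable {D V : Type} [Finite D] {ρ σ : Perm D} {v : D → V} {S : Set D}

omit [Finite D] in
theorem IsMatching.notMem_iff (hσ : IsMatching S σ) (x : D) : σ x ∉ S ↔ x ∉ S := by
  rw [← hσ.fixed_iff, ← hσ.fixed_iff, σ.injective.eq_iff]

/-- The cell graph obtained by deleting the marked darts. -/
noncomputable def toCellGraph (hv : ρ.IsCycleLabelling v) (hσ : IsMatching S σ) :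
    CellGraph V where
  HalfEdge := {x // x ∉ S}
  finite_halfEdge := inferInstance
  rot := ρ.firstReturn S
  flip := σ.subtypePerm hσ.notMem_iff
  flip_flip x := Subtype.ext (hσ.involutive x.1)
  flip_ne x h := x.2 ((hσ.fixed_iff x.1).1 (congrArg Subtype.val h))
  vertex x := v x.1
  vertex_eq_iff x y := by rw [sameCycle_firstReturn, hv.eq_iff]

theorem connected_toCellGraph_iff (hv : ρ.IsCycleLabelling v) (hσ : IsMatching S σ) :
    (toCellGraph hv hσ).Connected ↔ IsTransitive ρ σ := by
  constructor
  · intro hc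
    obtain ⟨x₀, -⟩ := hv.surjective hc.nonempty.some
    refine ⟨⟨x₀⟩, fun P hP x y hx => ?_⟩
    have hPv : ∀ x y, v x = v y → (P x ↔ P y) := fun x y hxy =>
      Eq.to_iff (((hv.eq_iff x y).1 hxy).eq_of_invariant fun x => propext (hP.left x))
    have hwalk : ∀ i j, (SimpleGraph.fromRel fun i j : V => ∃ h, (toCellGraph hv hσ).vertex h = i ∧
        (toCellGraph hv hσ).vertex ((toCellGraph hv hσ).flip h) = j).Reachable i j →
        ∀ x y, v x = i → v y = j → P x → P y := by
      rintro i j ⟨w⟩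
      induction w with
      | nil => exact fun x y hx hy => (hPv x y (hx.trans hy.symm)).1
      | cons hadj w ih =>
        intro x y hx hy hPx
        rcases hadj.2 with ⟨z, rfl, rfl⟩ | ⟨z, rfl, rfl⟩
        · exact ih _ y rfl hy ((hP.right z.1).2 ((hPv _ _ hx).1 hPx))
        · exact ih _ y rfl hy ((hP.right z.1).1 ((hPv _ _ hx).1 hPx))
    exact hwalk _ _ (hc.preconnected (v x) (v y)) x y rfl rfl hx
  · intro hT
    have hne := hT.nonempty
    refine (SimpleGraph.connected_iff _).2 ⟨fun i j => ?_, ⟨v (Classical.arbitrary D)⟩⟩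
    obtain ⟨x, rfl⟩ := hv.surjective i
    obtain ⟨y, rfl⟩ := hv.surjective j
    refine hT.imp (fun z => SimpleGraph.Reachable _ (v x) (v z))
      ⟨fun z => by rw [hv.apply], fun z => ?_⟩ x y (SimpleGraph.Reachable.refl _)
    by_cases hz : v z = v (σ z)
    · rw [hz]
    · have hzS : z ∉ S := fun h => hz (by rw [(hσ.fixed_iff z).2 h])
      have hadj : (SimpleGraph.fromRel fun i j : V => ∃ h, (toCellGraph hv hσ).vertex h = i ∧
          (toCellGraph hv hσ).vertex ((toCellGraph hv hσ).flip h) = j).Adj (v z) (v (σ z)) :=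
        ⟨hz, Or.inl ⟨⟨z, hzS⟩, rfl, rfl⟩⟩
      exact ⟨fun h => h.trans hadj.symm.reachable, fun h => h.trans hadj.reachable⟩

theorem isConnectedOfGenus_toCellGraph_iff (hv : ρ.IsCycleLabelling v) (hσ : IsMatching S σ)
    (g : ℕ) : (toCellGraph hv hσ).IsConnectedOfGenus g ↔ IsMap g ρ S σ := by
  have h1 : (Nat.card {x // x ∉ S} : ℤ) = 2 * (toCellGraph hv hσ).numEdges := by
    have := (toCellGraph hv hσ).finite_halfEdge
    exact_mod_cast card_eq_two_mul_numCycles (toCellGraph hv hσ).flip_flip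
      (toCellGraph hv hσ).flip_ne
  have h2 : (toCellGraph hv hσ).numFaces = (ρ * σ).numCycles := by
    have hl := isCycleLabelling_mk (ρ * σ)
    rw [numCycles_eq_firstReturn_add (S := S) hl, firstReturn_mul (fun x hx => (hσ.fixed_iff x).2 hx)
      hσ.notMem_iff]
    have hag : ∀ x ∈ S, ρ x = (ρ * σ) x := fun x hx => by
      rw [Perm.mul_apply, (hσ.fixed_iff x).2 hx]
    have hrep := Function.surjInv_eq hv.surjective
    set rep := Function.surjInv hv.surjective
    have hmem : ∀ i, (∀ x : {x // x ∉ S}, v x.1 ≠ i) → ∀ y, ρ.SameCycle (rep i) y → y ∈ S := by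
      intro i hi y hy
      by_contra hyS
      exact hi ⟨y, hyS⟩ (by rw [← (hv.eq_iff _ _).2 hy, hrep])
    refine congrArg₂ _ rfl (Nat.card_eq_of_bijective
      (fun i : {i // ∀ x : {x // x ∉ S}, v x.1 ≠ i} =>
        (⟨Quotient.mk _ (rep i.1), fun x hx hxi => ?_⟩ :
          {q // ∀ x, x ∉ S → Quotient.mk (SameCycle.setoid (ρ * σ)) x ≠ q})) ⟨?_, ?_⟩)
    · rw [hl.eq_iff, sameCycle_comm, ← sameCycle_iff_of_eqOn hag (hmem i.1 i.2)] at hxi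
      exact hx (hmem i.1 i.2 x hxi)
    · rintro ⟨i, hi⟩ ⟨j, hj⟩ hij
      rw [Subtype.mk_eq_mk, hl.eq_iff, ← sameCycle_iff_of_eqOn hag (hmem i hi), ← hv.eq_iff, hrep,
        hrep] at hij
      exact Subtype.ext hij
    · rintro ⟨q, hq⟩
      obtain ⟨x, rfl⟩ := Quotient.mk_surjective q
      have hx : ∀ y, (ρ * σ).SameCycle x y → y ∈ S := fun y hy => by
        by_contra hyS
        exact hq y hyS ((hl.eq_iff _ _).2 hy.symm)
      have hx' := fun y => sameCycle_iff_of_eqOn (y := y) (fun z hz => (hag z hz).symm) hx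
      refine ⟨⟨v x, fun y hy => y.2 (hx y.1 ((hx' _).2 ((hv.eq_iff _ _).1 hy.symm)))⟩, ?_⟩
      rw [Subtype.mk_eq_mk, hl.eq_iff, sameCycle_comm, hx', ← hv.eq_iff, hrep]
  have h3 := hv.numCycles_eq
  have h4 := connected_toCellGraph_iff hv hσ
  constructor
  · rintro ⟨hc, he⟩
    refine ⟨hσ, h4.1 hc, ?_⟩
    rw [twiceEuler, h1, ← h2, h3]
    linarith
  · intro h
    have he := h.euler
    rw [twiceEuler, h1, ← h2, h3] at he
    exact ⟨h4.2 h.toIsTransitive, by linarith⟩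

omit [Finite D] in
theorem exists_basePoint [Nonempty D] (v : D → V) (S : Set D) :
    ∃ a : V → D, ∀ x, x ∉ S → a (v x) ∉ S ∧ v (a (v x)) = v x := by
  classical
  choose a ha using fun i : V => show ∃ y : D, ∀ x, x ∉ S → v x = i → y ∉ S ∧ v y = i by
    by_cases h : ∃ y, y ∉ S ∧ v y = i
    · obtain ⟨y, hy⟩ := h
      exact ⟨y, fun _ _ _ => hy⟩
    · exact ⟨Classical.arbitrary D, fun x hx hxi => absurd ⟨x, hx, hxi⟩ h⟩
  exact ⟨a, fun x hx => ha _ x hx rfl⟩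

omit [Finite D] in
theorem existsUnique_basePoint {a : V → D}
    (ha : ∀ x, x ∉ S → a (v x) ∉ S ∧ v (a (v x)) = v x) (x : {x // x ∉ S}) :
    ∃! y : {x // x ∉ S}, y ∈ {y : {x // x ∉ S} | y.1 = a (v y.1)} ∧ v y.1 = v x.1 := by
  obtain ⟨h1, h2⟩ := ha x.1 x.2
  refine ⟨⟨a (v x.1), h1⟩, ⟨?_, h2⟩, ?_⟩
  · change a (v x.1) = a (v (a (v x.1)))
    rw [h2]
  · rintro y ⟨hy, hyx⟩
    have hy : y.1 = a (v y.1) := hy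
    exact Subtype.ext (by rw [hy, hyx])

/-- The cell graph obtained by deleting the marked darts, with arrows at given darts. -/
noncomputable def toArrowedCellGraph (hv : ρ.IsCycleLabelling v) (hσ : IsMatching S σ) (a : V → D)
    (ha : ∀ x, x ∉ S → a (v x) ∉ S ∧ v (a (v x)) = v x) : ArrowedCellGraph V where
  toCellGraph := toCellGraph hv hσ
  arrows := {x : {x // x ∉ S} | x.1 = a (v x.1)}
  existsUnique_arrow x := existsUnique_basePoint ha x

/-- The number of arrowed cell graphs, as a number of involutions of a fixed set of darts. -/
theorem count_eq_numMaps (hv : ρ.IsCycleLabelling v) {μ : V → ℕ}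
    (hμ : ∀ i, Nat.card {x // v x = i ∧ x ∉ S} = μ i) (g : ℕ) :
    ArrowedCellGraph.count g μ = numMaps g ρ S := by
  classical
  rcases isEmpty_or_nonempty D with hD | hD
  · have h1 : IsEmpty {σ // IsMap g ρ S σ} := ⟨fun σ => hD.false σ.2.nonempty.some⟩
    have h2 : IsEmpty (Quotient (ArrowedCellGraph.setoid g μ)) := ⟨fun q => by
      obtain ⟨Γ, rfl⟩ := Quotient.mk_surjective q
      obtain ⟨x, -⟩ := hv.surjective Γ.2.1.1.nonempty.some
      exact hD.false x⟩
    rw [ArrowedCellGraph.count, numMaps, Nat.card_of_isEmpty, Nat.card_of_isEmpty]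
  obtain ⟨a, ha⟩ := exists_basePoint v S
  have hdeg : ∀ i, Nat.card {x : {x // x ∉ S} // v x.1 = i} = μ i := by
    intro i
    rw [← hμ]
    exact Nat.card_congr ⟨fun x => ⟨x.1.1, x.2, x.1.2⟩, fun x => ⟨⟨x.1, x.2.2⟩, x.2.1⟩,
      fun _ => rfl, fun _ => rfl⟩
  refine (Nat.card_eq_of_bijective (fun σ : {σ // IsMap g ρ S σ} =>
    Quotient.mk (ArrowedCellGraph.setoid g μ) ⟨toArrowedCellGraph hv σ.2.toIsMatching a ha,
      (isConnectedOfGenus_toCellGraph_iff hv σ.2.toIsMatching g).2 σ.2, hdeg⟩) ⟨?_, ?_⟩).symm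
  · rintro ⟨σ, hσ⟩ ⟨τ, hτ⟩ heq
    obtain ⟨f, hf1, hf2, hf3, hf4⟩ : ∃ f : {x // x ∉ S} ≃ {x // x ∉ S},
        (∀ x, f (ρ.firstReturn S x) = ρ.firstReturn S (f x)) ∧
        (∀ x, f (σ.subtypePerm hσ.notMem_iff x) = τ.subtypePerm hτ.notMem_iff (f x)) ∧
        (∀ x, v (f x).1 = v x.1) ∧ ∀ x, (f x).1 = a (v (f x).1) ↔ x.1 = a (v x.1) :=
      Quotient.exact heq
    have hf : ∀ x, f x = x := by
      intro x
      obtain ⟨y, ⟨hy, hyx⟩, -⟩ := existsUnique_basePoint ha x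
      have hfy : f y = y := (existsUnique_basePoint ha y).unique
        ⟨(hf4 y).2 hy, hf3 y⟩ ⟨hy, rfl⟩
      exact apply_eq_self_of_commute hf1 hfy
        (sameCycle_firstReturn.2 ((hv.eq_iff _ _).1 hyx))
    refine Subtype.ext (Perm.ext fun x => ?_)
    by_cases hx : x ∈ S
    · rw [(hσ.fixed_iff x).2 hx, (hτ.fixed_iff x).2 hx]
    · have h1 := hf2 ⟨x, hx⟩
      rw [hf, hf] at h1
      exact congrArg Subtype.val h1
  · intro q
    obtain ⟨⟨Γ, hΓ, hΓdeg⟩, rfl⟩ := Quotient.mk_surjective q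
    have := Γ.finite_halfEdge
    obtain ⟨f, hf1, hf2, hf3⟩ := exists_equiv_of_card_eq (r := ρ.firstReturn S) (r' := Γ.rot)
      (v := fun x : {x // x ∉ S} => v x.1) (v' := Γ.vertex)
      (fun x y => by rw [sameCycle_firstReturn, hv.eq_iff]) Γ.vertex_eq_iff
      (fun i => ((hdeg i).trans (hΓdeg i).symm)) (existsUnique_basePoint ha) Γ.existsUnique_arrow
    have hof : ∀ x (hx : x ∉ S), ofSubtype (f.permCongr.symm Γ.flip) x =
        (f.symm (Γ.flip (f ⟨x, hx⟩))).1 := fun x hx =>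
      ofSubtype_apply_of_mem (p := fun x => x ∉ S) _ hx
    have hσ : IsMatching S (ofSubtype (f.permCongr.symm Γ.flip)) := by
      refine ⟨fun x => ?_, fun x => ?_⟩ <;> by_cases hx : x ∈ S
      · have h1 : ofSubtype (f.permCongr.symm Γ.flip) x = x :=
          ofSubtype_apply_of_not_mem (p := fun x => x ∉ S) _ (not_not.2 hx)
        rw [h1, h1]
      · rw [hof x hx, hof _ (f.symm (Γ.flip (f ⟨x, hx⟩))).2]
        simp [Γ.flip_flip]
      · exact iff_of_true (ofSubtype_apply_of_not_mem (p := fun x => x ∉ S) _ (not_not.2 hx)) hx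
      · refine iff_of_false (fun h => Γ.flip_ne (f ⟨x, hx⟩) (f.symm.injective ?_)) hx
        rw [hof x hx] at h
        rw [f.symm_apply_apply]
        exact Subtype.ext h
    have hflip : ∀ x, f (subtypePerm _ hσ.notMem_iff x) = Γ.flip (f x) := fun x => by
      rw [← f.eq_symm_apply]
      exact Subtype.ext (hof x.1 x.2)
    have hmap : IsMap g ρ S (ofSubtype (f.permCongr.symm Γ.flip)) := by
      rw [← isConnectedOfGenus_toCellGraph_iff hv hσ g]
      refine CellGraph.isConnectedOfGenus_of_equiv (Γ := Γ.toCellGraph) f.symm (fun h => ?_)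
        (fun h => ?_) (fun h => ?_) hΓ
      · exact f.symm_apply_eq.2
          ((congrArg Γ.rot (f.apply_symm_apply h).symm).trans (hf1 (f.symm h)).symm)
      · exact f.symm_apply_eq.2
          ((congrArg Γ.flip (f.apply_symm_apply h).symm).trans (hflip (f.symm h)).symm)
      · exact (hf2 (f.symm h)).symm.trans (by rw [f.apply_symm_apply])
    exact ⟨⟨_, hmap⟩, Quotient.sound ⟨f, hf1, hflip, hf2, hf3⟩⟩

/-! ### The recursion for the number of arrowed cell graphs -/

/-- Every assignment of degrees is realized by a permutation with marked points. -/
theorem exists_realization {V : Type} [Finite V] (μ : V → ℕ) :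
    ∃ (D : Type) (_ : Finite D) (ρ : Perm D) (v : D → V) (S : Set D), ρ.IsCycleLabelling v ∧
      (∀ i, Nat.card {x // v x = i ∧ x ∉ S} = μ i) ∧ ∀ x, 0 < μ (v x) → x ∉ S := by
  refine ⟨Σ i : V, Fin (μ i - 1 + 1), inferInstance,
    Equiv.sigmaCongrRight fun i => Equiv.addRight (1 : Fin (μ i - 1 + 1)), Sigma.fst,
    {x | μ x.1 = 0}, ⟨fun i => ⟨⟨i, 0⟩, rfl⟩, ?_⟩, fun i => ?_, fun x hx h => hx.ne' h⟩
  · have hpow : ∀ (n : ℕ) (x : Σ i : V, Fin (μ i - 1 + 1)),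
        ((Equiv.sigmaCongrRight fun i => Equiv.addRight (1 : Fin (μ i - 1 + 1))) ^ n) x =
          ⟨x.1, x.2 + Fin.ofNat (μ x.1 - 1 + 1) n⟩ := by
      intro n x
      induction n with
      | zero => simp
      | succ n ih =>
        rw [pow_succ', Perm.mul_apply, ih]
        have h1 : Fin.ofNat (μ x.1 - 1 + 1) (n + 1) = Fin.ofNat (μ x.1 - 1 + 1) n + 1 := by
          ext
          simp [Fin.val_add]
        rw [h1, ← add_assoc]
        rfl
    refine fun x y => ⟨?_, fun h => ?_⟩
    · obtain ⟨i, a⟩ := x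
      obtain ⟨j, b⟩ := y
      rintro (rfl : i = j)
      refine ⟨((b - a).1 : ℕ), ?_⟩
      have h1 : Fin.ofNat (μ i - 1 + 1) (b - a).1 = b - a := by
        ext
        simp
      rw [zpow_natCast, hpow, h1, add_sub_cancel]
    · obtain ⟨n, rfl⟩ := h.exists_nat_pow_eq
      rw [hpow]
  · rcases Nat.eq_zero_or_pos (μ i) with h0 | h0
    · rw [h0]
      have : IsEmpty {x : Σ i : V, Fin (μ i - 1 + 1) // x.1 = i ∧ x ∉ {x | μ x.1 = 0}} :=
        ⟨fun x => x.2.2 (by rw [← x.2.1] at h0; exact h0)⟩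
      exact Nat.card_of_isEmpty
    · have h1 : Nat.card (Fin (μ i - 1 + 1)) = μ i := by
        rw [Nat.card_eq_fintype_card, Fintype.card_fin]
        omega
      conv_rhs => rw [← h1]
      refine (Nat.card_eq_of_bijective (fun a => ⟨⟨i, a⟩, rfl, h0.ne'⟩) ⟨fun a b hab => ?_, ?_⟩).symm
      · simpa using hab
      · rintro ⟨⟨j, a⟩, rfl, _⟩
        exact ⟨a, rfl⟩

/-- Relabelling the vertices. -/
theorem count_congr {V W : Type} [Finite W] (e : V ≃ W) (g : ℕ) (μ : W → ℕ) :
    ArrowedCellGraph.count g (fun i => μ (e i)) = ArrowedCellGraph.count g μ := by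
  obtain ⟨D, _, ρ, v, S, hv, hμ, -⟩ := exists_realization μ
  rw [count_eq_numMaps hv hμ, count_eq_numMaps (v := fun x => e.symm (v x))
    (hv.of_injective e.injective fun x => e.apply_symm_apply _) fun i => ?_]
  rw [← hμ]
  simp only [e.symm_apply_eq]

theorem IsPairOfMaps.imp {D : Type*} {g₁ g₂ g₁' g₂' : ℕ} {ρ σ : Perm D} {S : Set D}
    {p p' : D → Prop} (hp : IsPairOfMaps g₁ g₂ ρ S p σ) (hp' : IsPairOfMaps g₁' g₂' ρ S p' σ) {h : D}
    (hh : p h) (hh' : p' h) (x : D) (hx : p x) : p' x :=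
  hp.left.imp (fun z => p' z.1)
    ⟨fun z => hp'.invariant.left z.1, fun z => hp'.invariant.right z.1⟩ ⟨h, hh⟩ ⟨x, hx⟩ hh'

section

variable {D : Type} [Finite D] {ρ : Perm D} {S : Set D} {h k : D}

theorem numMaps_subtypePerm_eq_count {V W : Type} {v : D → V} (hv : ρ.IsCycleLabelling v)
    {d : V → ℕ} (hd : ∀ i, Nat.card {x // v x = i ∧ x ∉ S} = d i) {ι : W → V}
    (hι : Function.Injective ι) {p : D → Prop} (hp : ∀ x, p x ↔ v x ∈ Set.range ι)
    (hρ : ∀ x, p (ρ x) ↔ p x) (g : ℕ) :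
    numMaps g (ρ.subtypePerm hρ) (Subtype.val ⁻¹' S) =
      ArrowedCellGraph.count g fun i => d (ι i) := by
  obtain ⟨w, hw, hwv⟩ := hv.exists_subtypePerm hι hp hρ
  refine (count_eq_numMaps hw (fun i => ?_) g).symm
  rw [← hd]
  refine Nat.card_eq_of_bijective (fun x => ⟨x.1.1, by rw [← hwv, x.2.1], x.2.2⟩) ⟨?_, ?_⟩
  · exact fun x y hxy => Subtype.ext (Subtype.ext (Subtype.mk.inj hxy))
  · rintro ⟨x, hx, hxS⟩
    exact ⟨⟨⟨x, (hp x).2 ⟨i, hx.symm⟩⟩, hι (by rw [hwv, hx]), hxS⟩, rfl⟩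

/-- Removing the loop `{h, k}`, where `w` labels the vertices after the removal. -/
theorem card_isMap_of_sameCycle [DecidableEq D] (g : ℕ) (hhk : h ≠ k) (hh : h ∉ S) (hk : k ∉ S)
    (hs : ρ.SameCycle h k) {W : Type} [Fintype W] [DecidableEq W] {w : D → Option (Option W)}
    (hw : (swap h k * ρ).IsCycleLabelling w) (hwh : w h = none) (hwk : w k = some none)
    {d : Option (Option W) → ℕ}
    (hd : ∀ i, Nat.card {x // w x = i ∧ x ∉ insert h (insert k S)} = d i) :
    Nat.card {σ // IsMap g ρ S σ ∧ σ h = k} =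
      (if 0 < g then ArrowedCellGraph.count (g - 1) d else 0) +
      ∑ q ∈ Finset.HasAntidiagonal.antidiagonal g, ∑ I : Finset W,
        ArrowedCellGraph.count q.1 (fun o : Option {i // i ∈ I} => d (o.map fun i => some i.1)) *
        ArrowedCellGraph.count q.2
          (fun o : Option {i // i ∈ Iᶜ} => d (some (o.map Subtype.val))) := by
  have hι : ∀ I : Finset W, Function.Injective
      (fun o : Option {i // i ∈ I} => o.map fun i => some i.1) := fun I =>
    Option.map_injective ((Option.some_injective _).comp Subtype.val_injective)
  have hκ : ∀ I : Finset W, Function.Injective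
      (fun o : Option {i // i ∈ Iᶜ} => some (o.map Subtype.val)) := fun I =>
    (Option.some_injective _).comp (Option.map_injective Subtype.val_injective)
  let p : Finset W → D → Prop := fun I x =>
    w x ∈ Set.range fun o : Option {i // i ∈ I} => o.map fun i => some i.1
  have hpnone : ∀ I x, w x = none → p I x := fun I x hx => ⟨none, hx.symm⟩
  have hpsn : ∀ I x, w x = some none → ¬ p I x := by
    rintro I x hx ⟨_ | i, hi⟩ <;> rw [hx] at hi <;> simp at hi
  have hpss : ∀ I x i, w x = some (some i) → (p I x ↔ i ∈ I) := by
    refine fun I x i hx => ⟨?_, fun hi => ⟨some ⟨i, hi⟩, hx.symm⟩⟩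
    rintro ⟨_ | j, hj⟩ <;> rw [hx] at hj <;> simp at hj
    exact hj ▸ j.2
  have hp' : ∀ I x, ¬ p I x ↔
      w x ∈ Set.range fun o : Option {i // i ∈ Iᶜ} => some (o.map Subtype.val) := by
    intro I x
    rcases hx : w x with _ | _ | i
    · refine iff_of_false (not_not.2 (hpnone I x hx)) ?_
      rintro ⟨o, ho⟩
      simp at ho
    · exact iff_of_true (hpsn I x hx) ⟨none, rfl⟩
    · rw [hpss I x i hx]
      refine ⟨fun hi => ⟨some ⟨i, by simpa using hi⟩, rfl⟩, ?_⟩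
      rintro ⟨_ | j, hj⟩ <;> simp at hj
      have := j.2
      rw [Finset.mem_compl] at this
      exact hj ▸ this
  have hpρ : ∀ I x, p I ((swap h k * ρ) x) ↔ p I x := fun I x => by
    simp only [p, hw.apply]
  have h1 : Nat.card {σ // IsMap g ρ S σ ∧ σ h = k} =
      ∑ z ∈ Finset.insertNone (Finset.HasAntidiagonal.antidiagonal g ×ˢ (Finset.univ : Finset (Finset W))),
        Nat.card {σ // z.elim
          (0 < g ∧ IsMap (g - 1) (swap h k * ρ) (insert h (insert k S)) σ) fun z =>
            IsPairOfMaps z.1.1 z.1.2 (swap h k * ρ) (insert h (insert k S)) (p z.2) σ} := by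
    rw [← card_subtype_eq_sum (P := fun σ =>
      (0 < g ∧ IsMap (g - 1) (swap h k * ρ) (insert h (insert k S)) σ) ∨
        ∃ (p : D → Prop) (q : ℕ × ℕ), p h ∧ ¬ p k ∧ q.1 + q.2 = g ∧
          IsPairOfMaps q.1 q.2 (swap h k * ρ) (insert h (insert k S)) p σ)]
    · exact Nat.card_congr ((Equiv.mulRight (swap h k)).subtypeEquiv fun σ =>
        isMap_iff_of_sameCycle g hhk hh hk hs)
    · intro σ
      constructor
      · rintro (hσ | ⟨p₀, q, hph, hpk, hq, hσ⟩)
        · exact ⟨none, by simp, hσ⟩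
        · classical
          have hp₀ : p₀ = p {i | ∃ x, w x = some (some i) ∧ p₀ x} := by
            have hconst : ∀ x y, w x = w y → (p₀ x ↔ p₀ y) := fun x y hxy =>
              Eq.to_iff (((hw.eq_iff x y).1 hxy).eq_of_invariant
                fun x => propext (hσ.invariant.left x))
            funext x
            refine propext ?_
            rcases hx : w x with _ | _ | i
            · exact iff_of_true ((hconst x h (hx.trans hwh.symm)).2 hph) (hpnone _ x hx)
            · exact iff_of_false (fun h => hpk ((hconst x k (hx.trans hwk.symm)).1 h))
                (hpsn _ x hx)
            · rw [hpss _ x i hx]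
              simp only [Finset.mem_filter, Finset.mem_univ, true_and]
              exact ⟨fun h => ⟨x, hx, h⟩, fun ⟨y, hy, h⟩ => (hconst x y (hx.trans hy.symm)).2 h⟩
          refine ⟨some (q, ({i | ∃ x, w x = some (some i) ∧ p₀ x} : Finset W)), by simpa using hq, ?_⟩
          rw [hp₀] at hσ
          exact hσ
      · rintro ⟨_ | ⟨q, I⟩, hz, hσ⟩
        · exact Or.inl hσ
        · exact Or.inr ⟨p I, q, hpnone I h hwh, hpsn I k hwk, by simpa using hz, hσ⟩
    · have hno : ∀ (σ : Perm D) (q : ℕ × ℕ) (I : Finset W), IsMap (g - 1) (swap h k * ρ) (insert h (insert k S)) σ →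
          ¬ IsPairOfMaps q.1 q.2 (swap h k * ρ) (insert h (insert k S)) (p I) σ := by
        intro σ q I hσ hσ'
        exact hpsn I k hwk (hσ.imp _ hσ'.invariant h k (hpnone I h hwh))
      rintro σ (_ | ⟨q, I⟩) - (_ | ⟨q', I'⟩) - hσ hσ'
      · rfl
      · exact absurd hσ' (hno σ q' I' hσ.2)
      · exact absurd hσ (hno σ q I hσ'.2)
      · simp only [Option.elim] at hσ hσ'
        have hI : I = I' := by
          ext i
          obtain ⟨x, hx⟩ := hw.surjective (some (some i))
          rw [← hpss I x i hx, ← hpss I' x i hx]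
          exact ⟨hσ.imp hσ' (hpnone I h hwh) (hpnone I' h hwh) x,
            hσ'.imp hσ (hpnone I' h hwh) (hpnone I h hwh) x⟩
        subst hI
        have e1 := hσ.left.euler.symm.trans hσ'.left.euler
        have e2 := hσ.right.euler.symm.trans hσ'.right.euler
        have e3 : q = q' := Prod.ext (by omega) (by omega)
        rw [e3]
  rw [h1, Finset.sum_insertNone, Finset.sum_product]
  congr 1
  · split_ifs with hg
    · rw [count_eq_numMaps hw hd]
      exact Nat.card_congr (Equiv.subtypeEquivRight fun σ => and_iff_right hg)
    · have : IsEmpty {σ : Perm D // 0 < g ∧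
          IsMap (g - 1) (swap h k * ρ) (insert h (insert k S)) σ} := ⟨fun σ => hg σ.2.1⟩
      exact @Nat.card_of_isEmpty _ this
  · refine Finset.sum_congr rfl fun q _ => Finset.sum_congr rfl fun I _ => ?_
    refine (card_isPairOfMaps q.1 q.2 (hpρ I) fun x => not_congr (hpρ I x)).trans ?_
    rw [numMaps_subtypePerm_eq_count hw hd (hι I) (fun x => Iff.rfl),
      numMaps_subtypePerm_eq_count hw hd (hκ I) (hp' I)]

end

section

variable {D W : Type} [Finite D] [DecidableEq D] {ρ : Perm D} {S : Set D} {h k : D}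
  {v : D → Option W} {m : ℕ} {μ : W → ℕ}

/-- The degrees after the contraction of an edge joining the vertices `none` and `some j`. -/
theorem numMaps_swap_mul_eq_count (hv : ρ.IsCycleLabelling v)
    (hμ : ∀ o, Nat.card {x // v x = o ∧ x ∉ S} = o.elim m μ) (hh : h ∉ S) (hk : k ∉ S) {j : W}
    (hvh : v h = none) (hvk : v k = some j) (g : ℕ) :
    numMaps g (swap h k * ρ) (insert h (insert k S)) =
      ArrowedCellGraph.count g
        (fun o : Option {i // i ≠ j} => o.elim (m + μ j - 2) fun i => μ i) := by
  classical
  have hhk : h ≠ k := fun e => by rw [e, hvk] at hvh; cases hvh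
  have hι : Function.Injective (Option.map (Subtype.val : {i // i ≠ j} → W)) :=
    Option.map_injective Subtype.val_injective
  have hr : ∀ i, i ∈ Set.range (Option.map (Subtype.val : {i // i ≠ j} → W)) ↔ i ≠ v k := by
    rw [hvk]
    rintro (_ | i)
    · exact iff_of_true ⟨none, rfl⟩ (by simp)
    · constructor
      · rintro ⟨_ | x, hx⟩ <;> simp at hx
        rw [← hx]
        simpa using x.2
      · exact fun hi => ⟨some ⟨i, fun e => hi (e ▸ rfl)⟩, rfl⟩
  choose w hw using fun x => show ∃ o : Option {i // i ≠ j},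
      (v x ≠ v k → o.map Subtype.val = v x) ∧ (v x = v k → o.map Subtype.val = v h) by
    by_cases hx : v x = v k
    · exact ⟨none, fun h => absurd hx h, fun _ => hvh.symm⟩
    · obtain ⟨o, ho⟩ := (hr _).2 hx
      exact ⟨o, fun _ => ho, fun h => absurd h hx⟩
  have hlab := hv.swap_mul_of_ne (by rw [hvh, hvk]; simp) hι hr (fun x => (hw x).1)
    fun x => (hw x).2
  refine (count_eq_numMaps hlab (fun o => ?_) g).symm
  have hwo : ∀ x, w x = o ↔ if v x = v k then o = none else v x = o.map Subtype.val := by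
    intro x
    rw [← hι.eq_iff]
    split_ifs with hx
    · rw [(hw x).2 hx, hvh]
      cases o <;> simp
    · rw [(hw x).1 hx]
  rcases o with _ | i
  · have h1 := card_notMem_insert_insert (S := S) (p := fun x => v x = none ∨ v x = some j)
      hhk hh hk (Or.inl hvh) (Or.inr hvk)
    have h2 : Nat.card {x // (v x = none ∨ v x = some j) ∧ x ∉ S} = m + μ j := by
      have e1 := hμ none
      have e2 := hμ (some j)
      simp only [Option.elim] at e1 e2
      rw [← e1, ← e2]
      change ({x | (v x = none ∨ v x = some j) ∧ x ∉ S}).ncard =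
        ({x | v x = none ∧ x ∉ S}).ncard + ({x | v x = some j ∧ x ∉ S}).ncard
      rw [← Set.ncard_union_eq]
      · congr 1
        ext x
        simp only [Set.mem_ofPred_eq, Set.mem_union]
        tauto
      · refine Set.disjoint_left.2 fun x hx hx' => ?_
        have := hx.1.symm.trans hx'.1
        cases this
    have h3 : ∀ x, w x = none ↔ v x = none ∨ v x = some j := fun x => by
      rw [hwo, hvk]
      by_cases hx : v x = some j <;> simp [hx]
    simp only [h3, Option.elim]
    omega
  · have e1 := hμ (some i.1)
    simp only [Option.elim] at e1 ⊢
    rw [← e1]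
    refine Nat.card_congr (Equiv.subtypeEquivRight fun x => ?_)
    have h3 : w x = some i ↔ v x = some i.1 := by
      rw [hwo, hvk]
      by_cases hx : v x = some j
      · simp [hx, i.2.symm]
      · simp [hx]
    rw [h3]
    refine and_congr_right fun hx => ?_
    have n1 : x ≠ h := fun e => by rw [e, hvh] at hx; cases hx
    have n2 : x ≠ k := fun e => by
      rw [e, hvk] at hx
      exact i.2 (Option.some.inj hx).symm
    simp [n1, n2]

/-- The recursion for the maps in which `h` is joined to `f ^ (α + 1) h`. -/
theorem card_isMap_of_pow [Fintype W] [DecidableEq W] (hv : ρ.IsCycleLabelling v)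
    (hμ : ∀ o, Nat.card {x // v x = o ∧ x ∉ S} = o.elim m μ) (hS : ∀ x, v x = none → x ∉ S)
    (hvh : v h = none) {α β : ℕ} (hm : α + β + 2 = m) (hk : (ρ ^ (α + 1)) h = k) (g : ℕ) :
    Nat.card {σ // IsMap g ρ S σ ∧ σ h = k} =
      (if 0 < g then ArrowedCellGraph.count (g - 1)
        (fun o : Option (Option W) => o.elim α fun o => o.elim β μ) else 0) +
      ∑ q ∈ Finset.HasAntidiagonal.antidiagonal g, ∑ I : Finset W,
        ArrowedCellGraph.count q.1 (fun o : Option {i // i ∈ I} => o.elim α fun i => μ i) *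
        ArrowedCellGraph.count q.2 (fun o : Option {i // i ∈ Iᶜ} => o.elim β fun i => μ i) := by
  classical
  have hcard : Nat.card {x // v x = v h} = m := by
    rw [hvh, ← show (none : Option W).elim m μ = m from rfl, ← hμ]
    exact Nat.card_congr (Equiv.subtypeEquivRight fun x => ⟨fun hx => ⟨hx, hS x hx⟩, fun hx => hx.1⟩)
  have hinj : ∀ s < m, ∀ t < m, (ρ ^ s) h = (ρ ^ t) h → s = t := fun s hs t ht hst => by
    rw [pow_apply_eq_pow_apply_iff_modEq hv.eq_iff, hcard] at hst
    exact hst.eq_of_lt_of_lt hs ht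
  have hvpow : ∀ s, v ((ρ ^ s) h) = none := fun s => by
    rw [← hvh, hv.eq_iff]
    exact sameCycle_pow_left.2 (SameCycle.refl _ _)
  have hvk : v k = none := hk ▸ hvpow _
  have hhk : h ≠ k := fun e => by
    have := hinj 0 (by omega) (α + 1) (by omega) (e.trans hk.symm)
    omega
  have hsame := (hv.eq_iff h k).1 (hvh.trans hvk.symm)
  have hiff := fun x => sameCycle_swap_mul_iff (x := x) hk (fun s hs e => by
    have := hinj s (by omega) (α + 1) (by omega) (e.trans hk.symm)
    omega) hhk
  have hlab := hv.swap_mul_of_eq hhk (hvh.trans hvk.symm)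
  have hwnone : ∀ x, (if (swap h k * ρ).SameCycle h x then none else some (v x)) = none ↔
      ∃ s < α + 1, x = (ρ ^ s) h := fun x => by rw [← hiff]; simp
  have hα : Nat.card {x // (∃ s < α + 1, x = (ρ ^ s) h) ∧ x ∉ insert h (insert k S)} = α := by
    have : {x | (∃ s < α + 1, x = (ρ ^ s) h) ∧ x ∉ insert h (insert k S)} =
        (fun s => (ρ ^ s) h) '' (Finset.Ioo 0 (α + 1) : Finset ℕ) := by
      ext x
      simp only [Set.mem_ofPred_eq, Set.mem_image, Finset.coe_Ioo, Set.mem_Ioo]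
      constructor
      · rintro ⟨⟨s, hs, rfl⟩, hx⟩
        refine ⟨s, ⟨Nat.pos_of_ne_zero fun h0 => hx ?_, hs⟩, rfl⟩
        rw [h0]
        exact Set.mem_insert _ _
      · rintro ⟨s, ⟨hs0, hs⟩, rfl⟩
        refine ⟨⟨s, hs, rfl⟩, ?_⟩
        rw [Set.mem_insert_iff, Set.mem_insert_iff, not_or, not_or]
        refine ⟨fun e => ?_, fun e => ?_, hS _ (hvpow s)⟩
        · have := hinj s (by omega) 0 (by omega) e
          omega
        · have := hinj s (by omega) (α + 1) (by omega) (e.trans hk.symm)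
          omega
    change ({x | (∃ s < α + 1, x = (ρ ^ s) h) ∧ x ∉ insert h (insert k S)}).ncard = α
    rw [this, Set.InjOn.ncard_image, Set.ncard_coe_finset]
    · simp
    · intro s hs t ht hst
      simp only [Finset.coe_Ioo, Set.mem_Ioo] at hs ht
      exact hinj s (by omega) t (by omega) hst
  have hβ : Nat.card {x // (¬ (∃ s < α + 1, x = (ρ ^ s) h) ∧ v x = none) ∧
      x ∉ insert h (insert k S)} = β := by
    have h1 := card_notMem_insert_insert (S := S) (p := fun x => v x = none)
      hhk (hS h hvh) (hS k hvk) hvh hvk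
    rw [hμ none] at h1
    have h2 : Nat.card {x // v x = none ∧ x ∉ insert h (insert k S)} =
        Nat.card {x // (∃ s < α + 1, x = (ρ ^ s) h) ∧ x ∉ insert h (insert k S)} +
        Nat.card {x // (¬ (∃ s < α + 1, x = (ρ ^ s) h) ∧ v x = none) ∧
          x ∉ insert h (insert k S)} := by
      change ({x | v x = none ∧ x ∉ insert h (insert k S)}).ncard =
        ({x | (∃ s < α + 1, x = (ρ ^ s) h) ∧ x ∉ insert h (insert k S)}).ncard +
        ({x | (¬ (∃ s < α + 1, x = (ρ ^ s) h) ∧ v x = none) ∧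
          x ∉ insert h (insert k S)}).ncard
      rw [← Set.ncard_union_eq]
      · congr 1
        ext x
        have : (∃ s < α + 1, x = (ρ ^ s) h) → v x = none := by
          rintro ⟨s, -, rfl⟩
          exact hvpow s
        simp only [Set.mem_ofPred_eq, Set.mem_union]
        generalize (∃ s < α + 1, x = (ρ ^ s) h) = q at this ⊢
        tauto
      · exact Set.disjoint_left.2 fun x hx hx' => hx'.1.1 hx.1
    simp only [Option.elim] at h1
    omega
  rw [card_isMap_of_sameCycle (d := fun o => o.elim α fun o => o.elim β μ) g hhk (hS h hvh)
    (hS k hvk) hsame hlab (if_pos (SameCycle.refl _ _))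
    (by rw [if_neg (not_sameCycle_swap_mul hhk hsame), hvk])]
  · congr 1
    refine Finset.sum_congr rfl fun q _ => Finset.sum_congr rfl fun I _ => ?_
    congr 2 <;> funext o <;> cases o <;> rfl
  · rintro (_ | o)
    · simp only [hwnone]
      exact hα
    · have hwo : ∀ x, (if (swap h k * ρ).SameCycle h x then none else some (v x)) = some o ↔
          ¬ (∃ s < α + 1, x = (ρ ^ s) h) ∧ v x = o := fun x => by rw [← hiff]; simp
      simp only [hwo]
      rcases o with _ | i
      · exact hβ
      · have e1 := hμ (some i)
        simp only [Option.elim] at e1 ⊢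
        rw [← e1]
        refine Nat.card_congr (Equiv.subtypeEquivRight fun x => ?_)
        constructor
        · rintro ⟨⟨h1, h2⟩, h3⟩
          exact ⟨h2, fun hx => h3 (Set.mem_insert_of_mem _ (Set.mem_insert_of_mem _ hx))⟩
        · rintro ⟨h2, h3⟩
          refine ⟨⟨?_, h2⟩, ?_⟩
          · rintro ⟨s, -, rfl⟩
            rw [hvpow] at h2
            cases h2
          · rw [Set.mem_insert_iff, Set.mem_insert_iff, not_or, not_or]
            refine ⟨fun e => ?_, fun e => ?_, h3⟩
            · rw [e, hvh] at h2
              cases h2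
            · rw [e, hvk] at h2
              cases h2

end

/-- The edge-removal recursion for the number of arrowed cell graphs. -/
theorem count_recursion {W : Type} [Fintype W] [DecidableEq W] (g : ℕ) {m : ℕ} (hm : 0 < m)
    (μ : W → ℕ) :
    ArrowedCellGraph.count g (fun o : Option W => o.elim m μ) =
      ∑ j, μ j * ArrowedCellGraph.count g
        (fun o : Option {i // i ≠ j} => o.elim (m + μ j - 2) fun i => μ i) +
      ∑ p ∈ loopSplittings m,
        ((if 0 < g then ArrowedCellGraph.count (g - 1)
          (fun o : Option (Option W) => o.elim p.1 fun o => o.elim p.2 μ) else 0) +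
        ∑ q ∈ Finset.HasAntidiagonal.antidiagonal g, ∑ I : Finset W,
          ArrowedCellGraph.count q.1 (fun o : Option {i // i ∈ I} => o.elim p.1 fun i => μ i) *
          ArrowedCellGraph.count q.2
            (fun o : Option {i // i ∈ Iᶜ} => o.elim p.2 fun i => μ i)) := by
  classical
  obtain ⟨D, _, ρ, v, S, hv, hμ, hS'⟩ := exists_realization fun o : Option W => o.elim m μ
  have := Fintype.ofFinite D
  have hS : ∀ x, v x = none → x ∉ S := fun x hx => hS' x (by rw [hx]; exact hm)
  obtain ⟨h, hvh⟩ := hv.surjective none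
  have hh := hS h hvh
  rw [count_eq_numMaps hv hμ g, numMaps,
    card_subtype_eq_sum Finset.univ (Q := fun k σ => IsMap g ρ S σ ∧ σ h = k)
      (fun σ => ⟨fun hσ => ⟨σ h, Finset.mem_univ _, hσ, rfl⟩, fun ⟨_, _, hσ, _⟩ => hσ⟩)
      (fun σ i _ j _ hi hj => hi.2.symm.trans hj.2),
    ← Finset.sum_fiberwise Finset.univ v, Fintype.sum_option, add_comm]
  have hzero : ∀ k, k ∈ S ∨ k = h → Nat.card {σ // IsMap g ρ S σ ∧ σ h = k} = 0 := by
    intro k hk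
    have : IsEmpty {σ // IsMap g ρ S σ ∧ σ h = k} := by
      refine ⟨fun ⟨σ, hσ, hσh⟩ => hh ?_⟩
      rcases hk with hk | hk
      · have h1 := (hσ.fixed_iff k).2 hk
        rw [← hσh, hσ.involutive] at h1
        rw [← hσ.fixed_iff, ← h1]
      · rw [← hσ.fixed_iff, hσh, hk]
    exact Nat.card_of_isEmpty
  congr 1
  · refine Finset.sum_congr rfl fun j _ => ?_
    rw [← Finset.sum_filter_add_sum_filter_not _ (fun x => x ∈ S),
      Finset.sum_eq_zero (fun x hx => hzero x (Or.inl (Finset.mem_filter.1 hx).2)), zero_add,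
      Finset.sum_congr rfl (fun x hx => ?_), Finset.sum_const, smul_eq_mul]
    · congr 1
      have h1 := hμ (some j)
      rw [Nat.card_eq_fintype_card, Fintype.card_subtype] at h1
      rw [Finset.filter_filter, h1]
      rfl
    · simp only [Finset.mem_filter, Finset.mem_univ, true_and] at hx
      rw [card_isMap_of_not_sameCycle g hh hx.2 (fun e => by
        rw [← hv.eq_iff, hvh, hx.1] at e; cases e),
        numMaps_swap_mul_eq_count hv hμ hh hx.2 hvh hx.1]
  · have hcard : Nat.card {x // v x = v h} = m := by
      rw [hvh, ← show (none : Option W).elim m μ = m from rfl, ← hμ]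
      exact Nat.card_congr
        (Equiv.subtypeEquivRight fun x => ⟨fun hx => ⟨hx, hS x hx⟩, fun hx => hx.1⟩)
    have hpow := pow_apply_eq_pow_apply_iff_modEq hv.eq_iff h
    rw [hcard] at hpow
    rw [← Finset.sum_erase (f := fun k => Nat.card {σ // IsMap g ρ S σ ∧ σ h = k}) _
      (hzero h (Or.inr rfl))]
    refine (Finset.sum_bij (fun p _ => (ρ ^ (p.1 + 1)) h) ?_ ?_ ?_ ?_).symm
    · intro p hp
      simp only [loopSplittings, Finset.mem_filter] at hp
      rw [Finset.mem_erase, Finset.mem_filter]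
      refine ⟨fun e => ?_, Finset.mem_univ _, ?_⟩
      · have := ((hpow (p.1 + 1) 0).1 e).eq_of_lt_of_lt (by omega) hm
        omega
      · rw [← hvh, hv.eq_iff]
        exact sameCycle_pow_left.2 (SameCycle.refl _ _)
    · intro p hp p' hp' e
      simp only [loopSplittings, Finset.mem_filter] at hp hp'
      have := ((hpow _ _).1 e).eq_of_lt_of_lt (by omega) (by omega)
      exact Prod.ext (by omega) (by omega)
    · intro x hx
      rw [Finset.mem_erase, Finset.mem_filter] at hx
      obtain ⟨n, rfl⟩ := ((hv.eq_iff h x).1 (hvh.trans hx.2.2.symm)).exists_nat_pow_eq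
      have h1 : (ρ ^ n) h = (ρ ^ (n % m)) h := (hpow _ _).2 (Nat.mod_modEq n m).symm
      have h2 : n % m ≠ 0 := fun e => hx.1 (by rw [h1, e]; rfl)
      have h3 := Nat.mod_lt n hm
      refine ⟨(n % m - 1, m - 1 - n % m), ?_, ?_⟩
      · simp only [loopSplittings, Finset.mem_filter, Finset.mem_product, Finset.mem_range]
        omega
      · dsimp only
        rw [h1, Nat.sub_add_cancel (by omega)]
    · intro p hp
      simp only [loopSplittings, Finset.mem_filter] at hp
      exact (card_isMap_of_pow hv hμ hS hvh hp.2 rfl g).symm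

end MarkedMap

end

/-! ### Frobenius algebras -/

namespace FrobeniusCounit

variable {K A : Type*} [Field K] [CommRing A] [Algebra K A] (F : FrobeniusCounit K A)
  {ι : Type*} [Fintype ι] [DecidableEq ι] (e : Module.Basis ι K A)

theorem eta_comm (u v : A) : F.eta u v = F.eta v u := by
  rw [eta_apply, eta_apply, mul_comm]

theorem isUnit_gram : IsUnit (Matrix.of fun a b => F.eta (e a) (e b)) := by
  rw [← Matrix.mulVec_injective_iff_isUnit]
  refine (injective_iff_map_eq_zero
    (Matrix.mulVecLin (Matrix.of fun a b => F.eta (e a) (e b)))).2 fun c hc => ?_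
  have h : ∑ b, c b • e b = 0 := F.eta_injective (by
    rw [map_zero]
    refine e.ext fun a => ?_
    have := congrFun hc a
    simp only [Matrix.mulVecLin_apply, Matrix.mulVec, dotProduct, Matrix.of_apply,
      Pi.zero_apply] at this
    rw [LinearMap.zero_apply, ← this, eta_comm, map_sum]
    exact Finset.sum_congr rfl fun b _ => by rw [map_smul, smul_eq_mul, mul_comm])
  exact funext (Fintype.linearIndependent_iff.1 e.linearIndependent c h)

/-- Expansion of an element in a basis by means of the Frobenius form. -/
theorem sum_etaInv_smul (x : A) : ∑ a, (∑ b, F.etaInv e a b * F.counit (x * e b)) • e a = x := by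
  refine F.eta_injective (e.ext fun c => ?_)
  have hinv : (Matrix.of fun a b => F.eta (e a) (e b)) * F.etaInv e = 1 :=
    Matrix.mul_nonsing_inv _ ((Matrix.isUnit_iff_isUnit_det _).1 (F.isUnit_gram e))
  have hc : ∀ b, ∑ a, F.eta (e c) (e a) * F.etaInv e a b = if c = b then 1 else 0 := fun b => by
    rw [← Matrix.one_apply, ← hinv, Matrix.mul_apply]
    rfl
  calc F.eta (∑ a, (∑ b, F.etaInv e a b * F.counit (x * e b)) • e a) (e c)
      = ∑ a, ∑ b, F.etaInv e a b * F.counit (x * e b) * F.eta (e c) (e a) := by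
        rw [eta_comm, map_sum]
        exact Finset.sum_congr rfl fun a _ => by rw [map_smul, smul_eq_mul, Finset.sum_mul]
    _ = ∑ b, (∑ a, F.eta (e c) (e a) * F.etaInv e a b) * F.counit (x * e b) := by
        rw [Finset.sum_comm]
        refine Finset.sum_congr rfl fun b _ => ?_
        rw [Finset.sum_mul]
        exact Finset.sum_congr rfl fun a _ => by ring
    _ = F.eta x (e c) := by
        simp only [hc, ite_mul, one_mul, zero_mul, Finset.sum_ite_eq, Finset.mem_univ, if_true]
        rfl

theorem sum_etaInv_mul_counit (x y : A) :
    ∑ a, ∑ b, F.etaInv e a b * (F.counit (x * e a) * F.counit (y * e b)) = F.counit (x * y) := by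
  conv_rhs => rw [← F.sum_etaInv_smul e y, Finset.mul_sum, map_sum]
  refine Finset.sum_congr rfl fun a _ => ?_
  rw [mul_smul_comm, map_smul, smul_eq_mul, Finset.sum_mul]
  exact Finset.sum_congr rfl fun b _ => by ring

theorem sum_etaInv_mul_etaInv (z x y : A) :
    ∑ a, ∑ b, ∑ k, ∑ l, F.eta z (e k * e l) * F.etaInv e k a * F.etaInv e l b *
      (F.counit (x * e a) * F.counit (y * e b)) = F.counit (z * (x * y)) := by
  conv_rhs => rw [← F.sum_etaInv_smul e x, ← F.sum_etaInv_smul e y, Finset.sum_mul_sum,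
    Finset.mul_sum, map_sum]
  have h : ∀ k l, F.counit (z * (((∑ a, F.etaInv e k a * F.counit (x * e a)) • e k) *
      ((∑ b, F.etaInv e l b * F.counit (y * e b)) • e l))) =
      ∑ a, ∑ b, F.eta z (e k * e l) * F.etaInv e k a * F.etaInv e l b *
        (F.counit (x * e a) * F.counit (y * e b)) := by
    intro k l
    rw [smul_mul_smul_comm, mul_smul_comm, map_smul, smul_eq_mul, Finset.sum_mul_sum,
      Finset.sum_mul]
    refine Finset.sum_congr rfl fun a _ => ?_
    rw [Finset.sum_mul]
    refine Finset.sum_congr rfl fun b _ => ?_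
    rw [eta_apply]
    ring
  simp only [Finset.mul_sum, map_sum, h]
  calc _ = ∑ a, ∑ k, ∑ b, ∑ l, F.eta z (e k * e l) * F.etaInv e k a * F.etaInv e l b *
      (F.counit (x * e a) * F.counit (y * e b)) :=
        Finset.sum_congr rfl fun a _ => Finset.sum_comm
    _ = ∑ k, ∑ a, ∑ l, ∑ b, F.eta z (e k * e l) * F.etaInv e k a * F.etaInv e l b *
      (F.counit (x * e a) * F.counit (y * e b)) := by
        rw [Finset.sum_comm]
        exact Finset.sum_congr rfl fun k _ => Finset.sum_congr rfl fun a _ => Finset.sum_comm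
    _ = _ := Finset.sum_congr rfl fun k _ => Finset.sum_comm

/-- The handle element `∑ η^{ab} e_a e_b`. -/
noncomputable def handle : A := ∑ a, ∑ b, F.etaInv e a b • (e a * e b)

theorem comul_eq_sum [FiniteDimensional K A] (z : A) :
    F.comul z = ∑ a, ∑ b, F.etaInv e a b • ((z * e a) ⊗ₜ[K] e b) := by
  have h : TensorProduct.dualDistribEquiv K A A (TensorProduct.congr F.toDual F.toDual
      (∑ a, ∑ b, F.etaInv e a b • ((z * e a) ⊗ₜ[K] e b))) =
      (LinearMap.mul' K A).dualMap (F.toDual z) := by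
    refine TensorProduct.ext' fun x y => ?_
    simp only [map_sum, map_smul, TensorProduct.congr_tmul, LinearMap.sum_apply,
      LinearMap.smul_apply, smul_eq_mul]
    have h1 : ∀ u w, F.toDual u w = F.counit (u * w) := fun u w => rfl
    have h2 : ∀ φ ψ : Module.Dual K A, TensorProduct.dualDistribEquiv K A A (φ ⊗ₜ ψ) (x ⊗ₜ y) =
        φ x * ψ y := fun φ ψ => by
      simp [TensorProduct.dualDistribEquiv, TensorProduct.dualDistribEquivOfBasis]
    simp only [h2, h1, LinearMap.dualMap_apply, LinearMap.mul'_apply]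
    rw [← mul_assoc, ← F.sum_etaInv_mul_counit e]
    refine Finset.sum_congr rfl fun a _ => Finset.sum_congr rfl fun b _ => ?_
    rw [mul_right_comm z, mul_comm (e b)]
  simp only [comul, LinearMap.comp_apply, LinearEquiv.coe_coe]
  rw [← h, LinearEquiv.symm_apply_apply, LinearEquiv.symm_apply_apply]

end FrobeniusCounit

/-! ### The values of a topological quantum field theory -/

theorem MultilinearMap.onTensor_tmul {K A : Type*} [Field K] [CommRing A] [Algebra K A] {n : ℕ}
    (f : MultilinearMap K (fun _ : Fin (n + 2) => A) K) (v : Fin n → A) (x y : A) :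
    f.onTensor v (x ⊗ₜ y) = f (Matrix.vecCons x (Matrix.vecCons y v)) := rfl

theorem prod_subfamily {A : Type*} [CommMonoid A] {n : ℕ} (I : Finset (Fin n)) (v : Fin n → A) :
    ∏ i, subfamily I v i = ∏ i ∈ I, v i := by
  rw [← Finset.prod_coe_sort I]
  exact Fintype.prod_equiv (I.orderIsoOfFin rfl).toEquiv _ _ fun i => rfl

theorem prod_vecCons {A : Type*} [CommMonoid A] {n : ℕ} (x : A) (v : Fin n → A) :
    ∏ i, Matrix.vecCons x v i = x * ∏ i, v i := by
  rw [Fin.prod_univ_succ]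
  rfl

theorem prod_append {A : Type*} [CommMonoid A] {m n : ℕ} (v : Fin m → A) (w : Fin n → A) :
    ∏ i, Fin.append v w i = (∏ i, v i) * ∏ i, w i := by
  rw [Fin.prod_univ_add]
  simp

namespace TQFT

variable {K A : Type*} [Field K] [CommRing A] [Algebra K A] {F : FrobeniusCounit K A}
  {ι : Type*} [Fintype ι] [DecidableEq ι] {e : Module.Basis ι K A} (T : TQFT F e)

theorem ω_zero_eq (n : ℕ) (v : Fin (n + 1) → A) : T.ω 0 (n + 1) v = F.counit (∏ i, v i) := by
  induction n using Nat.strong_induction_on with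
  | _ n ih =>
    match n with
    | 0 =>
      have : v = ![v 0] := by ext i; fin_cases i; rfl
      rw [this]
      simp [T.ω_zero_one]
    | 1 =>
      have : v = ![v 0, v 1] := by ext i; fin_cases i <;> rfl
      rw [this]
      simp [T.ω_zero_two, F.eta_apply]
    | 2 =>
      have : v = ![v 0, v 1, v 2] := by ext i; fin_cases i <;> rfl
      rw [this]
      simp [T.ω_zero_three, F.eta_apply, Fin.prod_univ_three]
    | m + 3 =>
      obtain ⟨x, y, rfl⟩ : ∃ (x : Fin (m + 2) → A) (y : Fin 2 → A), v = Fin.append x y :=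
        ⟨fun i => v (Fin.castAdd 2 i), fun i => v (Fin.natAdd (m + 2) i),
          (Fin.append_castAdd_natAdd (m := m + 2) (n := 2) (f := v)).symm⟩
      refine (T.ω_split 0 0 (m + 2) 2 (by omega) (by omega) (by omega) x y).trans ?_
      refine Eq.trans ?_ (congrArg F.counit (prod_append x y)).symm
      rw [← F.sum_etaInv_mul_counit e]
      refine Finset.sum_congr rfl fun a _ => Finset.sum_congr rfl fun b _ => ?_
      rw [ih (m + 2) (by omega), ih 2 (by omega), prod_append, prod_append]
      simp

theorem ω_eq (g n : ℕ) (v : Fin (n + 1) → A) :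
    T.ω g (n + 1) v = F.counit ((∏ i, v i) * F.handle e ^ g) := by
  induction g generalizing n with
  | zero => rw [ω_zero_eq, pow_zero, mul_one]
  | succ g ih =>
    rw [T.ω_handle g (n + 1) n.succ_pos]
    have h : ∀ a b, T.ω g (n + 1 + 2) (Fin.append v ![e a, e b]) =
        F.counit ((∏ i, v i) * F.handle e ^ g * (e a * e b)) := fun a b => by
      refine (ih (n + 2) _).trans ?_
      change F.counit ((∏ i : Fin (n + 1 + 2), Fin.append v ![e a, e b] i) * _) = _
      rw [prod_append]
      simp [mul_right_comm]
    rw [pow_succ, ← mul_assoc, FrobeniusCounit.handle, Finset.mul_sum, map_sum]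
    refine Finset.sum_congr rfl fun a _ => ?_
    rw [Finset.mul_sum, map_sum]
    refine Finset.sum_congr rfl fun b _ => ?_
    rw [h, mul_smul_comm, map_smul, smul_eq_mul, mul_comm]
    rfl

theorem ω_merge (g : ℕ) {n : ℕ} (v₁ : A) (v : Fin n → A) (j : Fin n) :
    T.ω g _ (Matrix.vecCons (v₁ * v j) (subfamily (Finset.univ.erase j) v)) =
      T.ω g (n + 1) (Matrix.vecCons v₁ v) := by
  rw [ω_eq, ω_eq, prod_vecCons, prod_vecCons, prod_subfamily, mul_assoc v₁,
    Finset.mul_prod_erase _ _ (Finset.mem_univ j)]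

theorem ω_onTensor_comul [FiniteDimensional K A] (g : ℕ) {n : ℕ} (v₁ : A) (v : Fin n → A) :
    (T.ω g (n + 2)).onTensor v (F.comul v₁) = T.ω (g + 1) (n + 1) (Matrix.vecCons v₁ v) := by
  rw [F.comul_eq_sum e, ω_eq, pow_succ', ← mul_assoc, prod_vecCons, FrobeniusCounit.handle,
    Finset.mul_sum, Finset.sum_mul, map_sum, map_sum]
  refine Finset.sum_congr rfl fun a _ => ?_
  rw [Finset.mul_sum, Finset.sum_mul, map_sum, map_sum]
  refine Finset.sum_congr rfl fun b _ => ?_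
  rw [map_smul, MultilinearMap.onTensor_tmul, ω_eq, prod_vecCons, prod_vecCons, mul_smul_comm,
    smul_mul_assoc, map_smul]
  congr 2
  rw [FrobeniusCounit.handle]
  ring

theorem sum_ω_mul_ω (g₁ g₂ : ℕ) {n : ℕ} (v₁ : A) (v : Fin n → A) (I : Finset (Fin n)) :
    ∑ a, ∑ b, ∑ k, ∑ l, F.eta v₁ (e k * e l) * F.etaInv e k a * F.etaInv e l b *
      (T.ω g₁ _ (Matrix.vecCons (e a) (subfamily I v)) *
        T.ω g₂ _ (Matrix.vecCons (e b) (subfamily Iᶜ v))) =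
      T.ω (g₁ + g₂) (n + 1) (Matrix.vecCons v₁ v) := by
  have h : ∀ (g : ℕ) (J : Finset (Fin n)) a, T.ω g _ (Matrix.vecCons (e a) (subfamily J v)) =
      F.counit ((∏ i ∈ J, v i) * F.handle e ^ g * e a) := fun g J a => by
    rw [ω_eq, prod_vecCons, prod_subfamily]
    congr 1
    ring
  simp only [h]
  rw [F.sum_etaInv_mul_etaInv e, ω_eq, prod_vecCons, ← Finset.prod_mul_prod_compl I]
  congr 1
  ring

end TQFT

/-! ### Relabelling by initial segments -/

namespace MarkedMap

theorem count_vecCons (g : ℕ) {n : ℕ} (m : ℕ) (μ : Fin n → ℕ) :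
    ArrowedCellGraph.count g (Matrix.vecCons m μ) =
      ArrowedCellGraph.count g fun o : Option (Fin n) => o.elim m μ := by
  rw [← count_congr (finSuccEquiv n)]
  congr 1
  funext i
  cases i using Fin.cases <;> simp

theorem count_vecCons_vecCons (g : ℕ) {n : ℕ} (m m' : ℕ) (μ : Fin n → ℕ) :
    ArrowedCellGraph.count g (Matrix.vecCons m (Matrix.vecCons m' μ)) =
      ArrowedCellGraph.count g
        fun o : Option (Option (Fin n)) => o.elim m fun o => o.elim m' μ := by
  rw [count_vecCons, ← count_congr (finSuccEquiv n).optionCongr]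
  congr 1
  funext i
  rcases i with _ | i
  · rfl
  · cases i using Fin.cases <;> simp

theorem count_vecCons_subfamily (g : ℕ) {n : ℕ} (m : ℕ) (μ : Fin n → ℕ) (I : Finset (Fin n))
    {p : Fin n → Prop} (hp : ∀ i, i ∈ I ↔ p i) :
    ArrowedCellGraph.count g (Matrix.vecCons m (subfamily I μ)) =
      ArrowedCellGraph.count g fun o : Option {i // p i} => o.elim m fun i => μ i := by
  rw [count_vecCons, ← count_congr
    (((I.orderIsoOfFin rfl).toEquiv.trans (Equiv.subtypeEquivRight hp)).optionCongr)]
  congr 1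
  funext i
  rcases i with _ | i <;> rfl

end MarkedMap

theorem mainTheorem5 {K A : Type*} [Field K] [CommRing A] [Algebra K A] [FiniteDimensional K A]
    (F : FrobeniusCounit K A) {ι : Type*} [Fintype ι] [DecidableEq ι] (e : Module.Basis ι K A)
    (T : TQFT F e) (g n : ℕ) (μ₁ : ℕ) (hμ₁ : 0 < μ₁) (μ : Fin n → ℕ) (v₁ : A) (v : Fin n → A) :
    (ArrowedCellGraph.count g (Matrix.vecCons μ₁ μ) : K) * T.ω g (n + 1) (Matrix.vecCons v₁ v) =
      (∑ j : Fin n,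
        (μ j : K) * (ArrowedCellGraph.count g (Matrix.vecCons (μ₁ + μ j - 2) (subfamily (Finset.univ.erase j) μ)) : K) *
          T.ω g _ (Matrix.vecCons (v₁ * v j) (subfamily (Finset.univ.erase j) v))) +
      (if 0 < g then
        ∑ p ∈ loopSplittings μ₁,
          (ArrowedCellGraph.count (g - 1) (Matrix.vecCons p.1 (Matrix.vecCons p.2 μ)) : K) *
            (T.ω (g - 1) (n + 2)).onTensor v (F.comul v₁)
       else 0) +
      ∑ p ∈ loopSplittings μ₁, ∑ q ∈ Finset.HasAntidiagonal.antidiagonal g, ∑ I : Finset (Fin n),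
        ∑ a, ∑ b, ∑ k, ∑ l,
          F.eta v₁ (e k * e l) * F.etaInv e k a * F.etaInv e l b *
            ((ArrowedCellGraph.count q.1 (Matrix.vecCons p.1 (subfamily I μ)) : K) *
              T.ω q.1 _ (Matrix.vecCons (e a) (subfamily I v))) *
            ((ArrowedCellGraph.count q.2 (Matrix.vecCons p.2 (subfamily Iᶜ μ)) : K) *
              T.ω q.2 _ (Matrix.vecCons (e b) (subfamily Iᶜ v))) := by
  have hrec := MarkedMap.count_recursion g hμ₁ μ
  rw [← MarkedMap.count_vecCons] at hrec
  rw [hrec]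
  push_cast
  rw [add_mul, Finset.sum_mul, Finset.sum_mul, add_assoc]
  congr 1
  · refine Finset.sum_congr rfl fun j _ => ?_
    rw [T.ω_merge, MarkedMap.count_vecCons_subfamily (p := fun i => i ≠ j) _ _ _ _ (by simp)]
  · have hif : (if 0 < g then ∑ p ∈ loopSplittings μ₁,
          (ArrowedCellGraph.count (g - 1) (Matrix.vecCons p.1 (Matrix.vecCons p.2 μ)) : K) *
            (T.ω (g - 1) (n + 2)).onTensor v (F.comul v₁) else 0) =
        ∑ p ∈ loopSplittings μ₁, (if 0 < g then
          (ArrowedCellGraph.count (g - 1) (fun o : Option (Option (Fin n)) =>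
            o.elim p.1 fun o => o.elim p.2 μ) : K) else 0) *
          T.ω g (n + 1) (Matrix.vecCons v₁ v) := by
      split_ifs with hg
      · refine Finset.sum_congr rfl fun p _ => ?_
        rw [T.ω_onTensor_comul, Nat.sub_add_cancel hg, MarkedMap.count_vecCons_vecCons]
      · simp
    rw [hif, ← Finset.sum_add_distrib]
    refine Finset.sum_congr rfl fun p _ => ?_
    rw [add_mul]
    congr 1
    rw [Finset.sum_mul]
    refine Finset.sum_congr rfl fun q hq => ?_
    rw [Finset.sum_mul]
    refine Finset.sum_congr rfl fun I _ => ?_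
    rw [← MarkedMap.count_vecCons_subfamily _ _ _ I (p := fun i => i ∈ I) (fun _ => Iff.rfl),
      ← MarkedMap.count_vecCons_subfamily _ _ _ Iᶜ (p := fun i => i ∈ Iᶜ) (fun _ => Iff.rfl),
      ← Finset.HasAntidiagonal.mem_antidiagonal.1 hq, ← T.sum_ω_mul_ω q.1 q.2 v₁ v I]
    simp only [Finset.mul_sum]
    refine Finset.sum_congr rfl fun a _ => Finset.sum_congr rfl fun b _ =>
      Finset.sum_congr rfl fun k _ => Finset.sum_congr rfl fun l _ => ?_
    ring
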